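/- Let $n\ge 1$ and $[n]=\{1,\dots,n\}$. Let $\mathbf T_n$ be the set of isomorphism classes of locally finite rooted trees $(T,o)$ with vertices labelled by $[n]$ (isomorphisms preserve adjacency, root and labels), with the $\sigma$-field generated by the isomorphism types of the first $h$ levels, $h\ge 0$. For a vector $\mathbf c\in\mathbb Z_{\ge 0}^n$ put $|\mathbf c|=\sum_j c_j$; let $N_i\subset\mathbf T_n$ be the set of trees whose root has label $i$, and $N_i(\mathbf c)\subset N_i$ the set of those whose root has exactly $c_j$ neighbours labelled $j$ for every $j$. For a probability measure $\sigma$ on $\mathbf T_n$ with $\sigma(N_i)>0$ put $\sigma(i)=\sigma(N_i)$ and $\sigma_i(\mathbf c)=\sigma(N_i(\mathbf c)\mid N_i)$, and let $D(\sigma_i)=\{|\mathbf c| : \sigma_i(\mathbf c)>0\}$. A probability measure $\mu$ on $\mathbf T_n$ is *reversible* (for simple random walk) if the root has positive degree $\mu$-almost surely and $\int_A \mathbf P((T,o)\to B)\,d\mu=\int_B \mathbf P((T,o)\to A)\,d\mu$ for all measurable $A,B\subset\mathbf T_n$, where $\mathbf P((T,o)\to A)$ is the probability that $(T,o')\in A$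 for a uniformly chosen neighbour $o'$ of $o$. Let $\nu$ be a multi-type Galton--Watson measure whose types are the elements of $[n]$, regarded as a probability measure on $\mathbf T_n$ (the label of a vertex is its type), and suppose that $\nu$ is strongly connected: for all $i,j\in[n]$ the root has type $i$ with positive probability and, given that the root has type $i$, the tree contains a vertex of type $j$ with positive probability. Write $\mu\sim_g\nu$ if, conditioned on the labels of the root and of its neighbours, the descendant subtrees of the neighbours of the root are, under $\mu$, independent Galton--Watson trees with the offspring distributions of $\nu$, the type of every vertex being its label. **Theorem.** There exists a reversible probability measure $\mu$ on $\mathbf T_n$ with $\mu\sim_g\nu$ if and only if there are numbers $p_{i,j}\ge 0$ $(i,j\in[n])$ with $\sum_j p_{i,j}=1$ for every $i$ such that 1. for all $i\in[n]$ and $d\in D(\nu_i)$, given that the root has type $i$ and $d$ children, the vector counting its children by type is multinomial with parameters $(p_{i,j})_{j\in[n]}$ (not depending on $d$), that is, $$\nu_i(\mathbf c \mid |\mathbf c|=d)=\frac{d!}{\prod_k c_k!}\prod_k p_{i,k}^{c_k}\qquad\text{for all }\mathbf c\text{ with }|\mathbf c|=d;$$ 2. for all $i_1,\dots,i_m=i_1$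 in $[n]$ with $p_{i_s,i_{s+1}}>0$ for $1\le s<m$, the numbers $p_{i_{s+1},i_s}$ are positive as well and $$\prod_{s=1}^{m-1}\frac{p_{i_s,i_{s+1}}}{p_{i_{s+1},i_s}}=1 .$$ In this case the reversible measure $\mu$ with $\mu\sim_g\nu$ is unique; $\mu(i)>0$ for all $i\in[n]$; for all $i\in[n]$ and $d\ge 0$, $d+1\in D(\mu_i)$ if and only if $d\in D(\nu_i)$, and the $\mu_i$-probability that the root has degree $d+1$ equals the $\nu_i$-probability that the root has $d$ children; and $(\mu(i))_{i\in[n]}$ is the unique solution of $$\frac{\mu(i)}{\mu(j)}=\frac{p_{j,i}}{p_{i,j}}\quad\text{for all } i,j\text{ with }p_{i,j}>0,\qquad \sum_{k=1}^n\mu(k)=1 .$$ -/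

import Mathlib

open MeasureTheory Set
open scoped ENNReal

namespace GWTree

/-! ### Rooted labelled trees up to isomorphism -/

/-- A locally finite rooted tree whose vertices carry labels in `Fin n`. Such a tree is
countable, so vertex types in `Type` represent every isomorphism class. -/
structure LTree (n : ℕ) where
  V : Type
  G : SimpleGraph V
  isTree : G.IsTree
  finite_nbrs : ∀ v, (G.neighborSet v).Finite
  root : V
  label : V → Fin n

namespace LTree

variable {n : ℕ}

/-- Rooted isomorphism: a graph isomorphism respecting the roots and the labels. -/
def Equiv (S T : LTree n) : Prop :=
  ∃ φ : S.G ≃g T.G, φ S.root = T.root ∧ ∀ v, T.label (φ v) = S.label v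

theorem equiv_equivalence : Equivalence (Equiv (n := n)) where
  refl S := ⟨SimpleGraph.Iso.refl, rfl, fun _ => rfl⟩
  symm := by
    rintro S T ⟨φ, h, hl⟩
    refine ⟨φ.symm, ?_, fun v => ?_⟩
    · rw [← h]; exact φ.symm_apply_apply _
    · rw [← hl, φ.apply_symm_apply]
  trans := by
    rintro S T U ⟨φ, h, hl⟩ ⟨ψ, h', hl'⟩
    refine ⟨φ.trans ψ, ?_, fun v => ?_⟩
    · rw [← h', ← h]; rfl
    · rw [← hl, ← hl']; rfl

instance instSetoid : Setoid (LTree n) := ⟨Equiv, equiv_equivalence⟩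

/-- The set of vertices at distance at most `h` from the root (the first `h` levels). -/
def ball (T : LTree n) (h : ℕ) : Set T.V := {v | T.G.dist T.root v ≤ h}

theorem root_mem_ball (T : LTree n) (h : ℕ) : T.root ∈ T.ball h := by simp [ball]

/-- The restrictions of `S` and `T` to the first `h` levels are isomorphic as rooted labelled
trees. -/
def BallEquiv (h : ℕ) (S T : LTree n) : Prop :=
  ∃ φ : S.G.induce (S.ball h) ≃g T.G.induce (T.ball h),
    φ ⟨S.root, S.root_mem_ball h⟩ = ⟨T.root, T.root_mem_ball h⟩ ∧
    ∀ v, T.label (φ v) = S.label v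

/-- The same tree, rooted at another vertex. -/
def reroot (T : LTree n) (v : T.V) : LTree n := { T with root := v }

/-- The number of neighbours of the root with label `j`. -/
noncomputable def nbrCount (T : LTree n) (j : Fin n) : ℕ :=
  {v | T.G.Adj T.root v ∧ T.label v = j}.ncard

end LTree

/-- The set of rooted isomorphism classes of (locally finite) rooted trees with labels
in `Fin n`. -/
abbrev Tn (n : ℕ) := Quotient (LTree.instSetoid (n := n))

variable {n : ℕ}

/-- The `σ`-field generated by the sets of trees whose first `h` levels are isomorphic to those
of a given tree. -/
instance instMeasurableSpaceTn : MeasurableSpace (Tn n) :=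
  MeasurableSpace.generateFrom
    {A | ∃ (h : ℕ) (S : LTree n), A = Quotient.mk _ '' {T | LTree.BallEquiv h S T}}

theorem ncard_eq_of_equiv {α β : Type} (φ : α ≃ β) {s : Set α} {t : Set β}
    (h : ∀ a, a ∈ s ↔ φ a ∈ t) : s.ncard = t.ncard := by
  have : t = φ '' s := by
    ext b
    constructor
    · intro hb
      exact ⟨φ.symm b, (h _).2 (by simpa using hb), by simp⟩
    · rintro ⟨a, ha, rfl⟩
      exact (h a).1 ha
  rw [this, Set.ncard_image_of_injective _ φ.injective]

/-- The label of the root. -/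
def rootLabel : Tn n → Fin n :=
  Quotient.lift (fun T => T.label T.root) (by
    rintro S T ⟨φ, h, hl⟩
    rw [← h, hl])

/-- The vector whose `j`-th entry is the number of neighbours of the root with label `j`. -/
noncomputable def nbrCount : Tn n → Fin n → ℕ :=
  Quotient.lift (fun T => T.nbrCount) (by
    rintro S T ⟨φ, h, hl⟩
    funext j
    refine ncard_eq_of_equiv φ.toEquiv fun v => ?_
    change S.G.Adj S.root v ∧ S.label v = j ↔ T.G.Adj T.root (φ v) ∧ T.label (φ v) = j
    rw [← h, hl, φ.map_adj_iff])

/-- The degree of the root. -/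
noncomputable def degree (t : Tn n) : ℕ := ∑ j, nbrCount t j

/-- The tree has a vertex with label `j`. -/
def HasLabel (j : Fin n) : Tn n → Prop :=
  Quotient.lift (fun T => ∃ v, T.label v = j) (by
    rintro S T ⟨φ, -, hl⟩
    refine propext ⟨?_, ?_⟩
    · rintro ⟨v, hv⟩
      exact ⟨φ v, by rw [hl, hv]⟩
    · rintro ⟨v, hv⟩
      exact ⟨φ.symm v, by rw [← hl, φ.apply_symm_apply, hv]⟩)

/-- Trees whose root has label `i`. -/
def N (i : Fin n) : Set (Tn n) := {t | rootLabel t = i}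

/-- Trees whose root has label `i` and exactly `c j` neighbours with label `j`, for each `j`. -/
def Nc (i : Fin n) (c : Fin n → ℕ) : Set (Tn n) := {t | rootLabel t = i ∧ nbrCount t = c}

/-! ### Simple random walk and reversibility -/

/-- The number of neighbours `v` of the root such that the tree rerooted at `v` lies in `A`. -/
noncomputable def stepCount (t : Tn n) (A : Set (Tn n)) : ℕ :=
  Quotient.lift
    (fun T : LTree n => {v | T.G.Adj T.root v ∧ (⟦T.reroot v⟧ : Tn n) ∈ A}.ncard) (by
    rintro S T ⟨φ, h, hl⟩
    refine ncard_eq_of_equiv φ.toEquiv fun v => ?_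
    change S.G.Adj S.root v ∧ _ ↔ T.G.Adj T.root (φ v) ∧ _
    have e : (⟦S.reroot v⟧ : Tn n) = ⟦T.reroot (φ v)⟧ := Quotient.sound ⟨φ, rfl, hl⟩
    rw [← h, φ.map_adj_iff]
    exact and_congr_right fun _ => iff_of_eq (congrArg (· ∈ A) e)) t

/-- The probability that simple random walk started at the root of `t` moves in one step to a
vertex such that the tree rerooted there lies in `A`. -/
noncomputable def stepProb (t : Tn n) (A : Set (Tn n)) : ℝ≥0∞ :=
  (stepCount t A : ℝ≥0∞) / (degree t : ℝ≥0∞)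

/-- Reversibility of a measure for simple random walk on rooted labelled trees. The walk needs a
neighbour to move to, so almost every tree has a root of positive degree. -/
def Reversible (μ : Measure (Tn n)) : Prop :=
  (∀ᵐ t ∂μ, 0 < degree t) ∧
  ∀ A B : Set (Tn n), MeasurableSet A → MeasurableSet B →
    ∫⁻ t in A, stepProb t B ∂μ = ∫⁻ t in B, stepProb t A ∂μ

/-! ### Two constructions of trees -/

theorem reachable_induction {V : Type} {G : SimpleGraph V} {u v : V} (h : G.Reachable u v)
    (P : V → Prop) (h0 : P u) (hs : ∀ a b, G.Adj a b → P a → P b) : P v := by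
  obtain ⟨w⟩ := h
  induction w with
  | nil => exact h0
  | cons hab _ ih => exact ih (hs _ _ hab h0)

/-- The type of an individual, when the root has type `i`. An individual is the list
of its ancestral steps, the most recent one first, and `(j, m) :: u` is the `m`-th
child of type `j` of `u`. -/
def indType (i : Fin n) : List (Fin n × ℕ) → Fin n
  | [] => i
  | x :: _ => x.1

/-- The individual `u` is born, if every `v` has `ω v j` children of type `j`. -/
def Born (ω : List (Fin n × ℕ) → Fin n → ℕ) : List (Fin n × ℕ) → Prop
  | [] => True
  | x :: u => Born ω u ∧ x.2 < ω u x.1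

/-- The graph joining each born individual to its children. -/
def familyGraph (ω : List (Fin n × ℕ) → Fin n → ℕ) :
    SimpleGraph {u : List (Fin n × ℕ) // Born ω u} where
  Adj u v := (∃ x, v.1 = x :: u.1) ∨ ∃ x, u.1 = x :: v.1
  symm := ⟨fun _ _ h => h.symm⟩
  loopless := ⟨by
    rintro u (⟨x, h⟩ | ⟨x, h⟩) <;> exact absurd (congrArg List.length h) (by simp)⟩

theorem familyGraph_isTree (ω : List (Fin n × ℕ) → Fin n → ℕ) : (familyGraph ω).IsTree := by
  have hroot : ∀ (l : List (Fin n × ℕ)) (hl : Born ω l),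
      (familyGraph ω).Reachable ⟨[], trivial⟩ ⟨l, hl⟩ := by
    intro l
    induction l with
    | nil => intro _; exact SimpleGraph.Reachable.refl _
    | cons x u ih =>
      intro hl
      refine (ih hl.1).trans (SimpleGraph.Adj.reachable ?_)
      exact Or.inl ⟨x, rfl⟩
  have key : ∀ (u v : {u : List (Fin n × ℕ) // Born ω u}) (x : Fin n × ℕ), v.1 = x :: u.1 →
      (familyGraph ω).IsBridge s(v, u) := by
    intro u v x hx
    rw [SimpleGraph.isBridge_iff]
    intro hr
    have := reachable_induction hr (fun w => v.1 <:+ w.1) (List.suffix_refl _) (by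
      intro a b hab ha
      rw [SimpleGraph.deleteEdges_adj] at hab
      obtain ⟨hab | hab, hne⟩ := hab
      · obtain ⟨y, hy⟩ := hab
        rw [hy]
        exact ha.trans (List.suffix_cons _ _)
      · obtain ⟨y, hy⟩ := hab
        rw [hy, List.suffix_cons_iff] at ha
        rcases ha with ha | ha
        · exfalso
          apply hne
          have hav : a = v := Subtype.ext (hy.trans ha.symm)
          rw [hx] at ha
          have hbu : b = u := Subtype.ext ((List.cons.inj ha).2.symm)
          rw [hav, hbu]
          rfl
        · exact ha)
    have := this.length_le
    rw [hx] at this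
    simp at this
  refine ⟨?_, ?_⟩
  · have : Nonempty {u : List (Fin n × ℕ) // Born ω u} := ⟨⟨[], trivial⟩⟩
    exact SimpleGraph.Connected.mk fun u v => (hroot u.1 u.2).symm.trans (hroot v.1 v.2)
  · rw [SimpleGraph.isAcyclic_iff_forall_adj_isBridge]
    rintro u v (⟨x, h⟩ | ⟨x, h⟩)
    · rw [Sym2.eq_swap]
      exact key u v x h
    · exact key v u x h

/-- The family tree in which the root has type `i` and every born individual `u` has exactly
`ω u j` children of type `j`. -/
def familyTree (i : Fin n) (ω : List (Fin n × ℕ) → Fin n → ℕ) : LTree n where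
  V := {u : List (Fin n × ℕ) // Born ω u}
  G := familyGraph ω
  isTree := familyGraph_isTree ω
  finite_nbrs u := by
    apply Set.Finite.of_finite_image (f := Subtype.val) _ Subtype.val_injective.injOn
    refine Set.Finite.subset
      ((Set.finite_range fun s : (Σ j, Fin (ω u.1 j)) => ((s.1, (s.2 : ℕ)) :: u.1)).union
        (Set.finite_singleton u.1.tail)) ?_
    rintro _ ⟨v, ⟨x, h⟩ | ⟨x, h⟩, rfl⟩
    · left
      have hv := v.2
      rw [h] at hv
      exact ⟨⟨x.1, ⟨x.2, hv.2⟩⟩, h.symm⟩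
    · right
      simp [h]
  root := ⟨[], trivial⟩
  label u := indType i u.1

/-- The graph obtained from disjoint copies of the trees `x s` by joining their roots to a new
vertex `none`. -/
def graftGraph {ι : Type} (x : ι → LTree n) : SimpleGraph (Option (Σ s, (x s).V)) where
  Adj
    | none, none => False
    | none, some b => b.2 = (x b.1).root
    | some a, none => a.2 = (x a.1).root
    | some a, some b => ∃ h : a.1 = b.1, (x b.1).G.Adj (h ▸ a.2) b.2
  symm := ⟨by
    rintro (_ | ⟨s, a⟩) (_ | ⟨t, b⟩) h
    · exact h
    · exact h
    · exact h
    · obtain ⟨h1, h2⟩ := h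
      dsimp only at h1
      subst h1
      exact ⟨rfl, h2.symm⟩⟩
  loopless := ⟨by
    rintro (_ | ⟨s, a⟩) h
    · exact h
    · obtain ⟨_, h2⟩ := h
      exact (x s).G.loopless.irrefl _ h2⟩

theorem graftGraph_isTree {ι : Type} (x : ι → LTree n) : (graftGraph x).IsTree := by
  classical
  have hroot : ∀ v, (graftGraph x).Reachable none v := by
    rintro (_ | ⟨s, a⟩)
    · exact SimpleGraph.Reachable.refl _
    · refine reachable_induction ((x s).isTree.connected.preconnected (x s).root a)
        (fun b => (graftGraph x).Reachable none (some ⟨s, b⟩)) ?_ ?_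
      · exact SimpleGraph.Adj.reachable (G := graftGraph x) (u := none)
          (v := some ⟨s, (x s).root⟩) rfl
      · intro b c hbc hb
        exact hb.trans (SimpleGraph.Adj.reachable (G := graftGraph x) (u := some ⟨s, b⟩)
          (v := some ⟨s, c⟩) ⟨rfl, hbc⟩)
  have key : ∀ s, (graftGraph x).IsBridge s(some ⟨s, (x s).root⟩, none) := by
    intro s
    rw [SimpleGraph.isBridge_iff]
    intro hr
    have := reachable_induction hr (fun w => ∃ b, w = some ⟨s, b⟩) ⟨_, rfl⟩ (by
      rintro a w haw ⟨b, rfl⟩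
      rw [SimpleGraph.deleteEdges_adj] at haw
      obtain ⟨haw, hne⟩ := haw
      rcases w with _ | ⟨t, c⟩
      · exfalso
        apply hne
        change b = (x s).root at haw
        rw [haw]
        rfl
      · obtain ⟨h1, -⟩ := haw
        dsimp only at h1
        subst h1
        exact ⟨c, rfl⟩)
    obtain ⟨b, hb⟩ := this
    cases hb
  refine ⟨?_, ?_⟩
  · exact SimpleGraph.Connected.mk fun u v => (hroot u).symm.trans (hroot v)
  · rw [SimpleGraph.isAcyclic_iff_forall_adj_isBridge]
    rintro (_ | ⟨s, a⟩) (_ | ⟨t, b⟩) h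
    · exact h.elim
    · change b = (x t).root at h
      subst h
      rw [Sym2.eq_swap]
      exact key t
    · change a = (x s).root at h
      subst h
      exact key s
    · obtain ⟨h1, h2⟩ := h
      dsimp only at h1
      subst h1
      dsimp only at h2
      rw [SimpleGraph.isBridge_iff]
      intro hr
      have hb := SimpleGraph.isAcyclic_iff_forall_adj_isBridge.1 (x s).isTree.isAcyclic h2
      rw [SimpleGraph.isBridge_iff] at hb
      apply hb
      let r : Option (Σ s, (x s).V) → (x s).V := fun w =>
        match w with
        | none => (x s).root
        | some c => if h : c.1 = s then h ▸ c.2 else (x s).root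
      have r_self : ∀ c, r (some ⟨s, c⟩) = c := fun c => by simp [r]
      have r_root : ∀ t, r (some ⟨t, (x t).root⟩) = (x s).root := fun t => by
        by_cases h : t = s
        · subst h; simp [r]
        · simp [r, h]
      have r_ne : ∀ t c, t ≠ s → r (some ⟨t, c⟩) = (x s).root := fun t c h => by simp [r, h]
      have := reachable_induction hr
        (fun w => ((x s).G.deleteEdges {s(a, b)}).Reachable a (r w)) (by
          rw [r_self]) (by
          intro u w huw hu
          rw [SimpleGraph.deleteEdges_adj] at huw
          obtain ⟨huw, hne⟩ := huw
          rcases u with _ | ⟨t, c⟩ <;> rcases w with _ | ⟨t', c'⟩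
          · exact hu
          · change c' = (x t').root at huw
            subst huw
            rw [r_root]
            exact hu
          · change c = (x t).root at huw
            subst huw
            rw [r_root] at hu
            exact hu
          · obtain ⟨h1, h2'⟩ := huw
            dsimp only at h1
            subst h1
            dsimp only at h2'
            by_cases ht : t = s
            · subst ht
              rw [r_self] at hu ⊢
              refine hu.trans (SimpleGraph.Adj.reachable ?_)
              rw [SimpleGraph.deleteEdges_adj]
              refine ⟨h2', fun hmem => hne ?_⟩
              rw [Set.mem_singleton_iff, Sym2.eq_iff] at hmem ⊢
              rcases hmem with ⟨rfl, rfl⟩ | ⟨rfl, rfl⟩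
              · exact Or.inl ⟨rfl, rfl⟩
              · exact Or.inr ⟨rfl, rfl⟩
            · rw [r_ne _ _ ht] at hu ⊢
              exact hu)
      rw [r_self] at this
      exact this

/-- The tree formed by joining the roots of disjoint copies of the trees `x s` by single edges
to a new vertex labelled `i`, which is the root of the new tree. -/
def graftTree {ι : Type} [Finite ι] (i : Fin n) (x : ι → LTree n) : LTree n where
  V := Option (Σ s, (x s).V)
  G := graftGraph x
  isTree := graftGraph_isTree x
  finite_nbrs := by
    rintro (_ | ⟨s, a⟩)
    · refine (Set.finite_range fun s => (some ⟨s, (x s).root⟩ : Option (Σ s, (x s).V))).subset ?_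
      rintro (_ | ⟨t, b⟩) h
      · exact h.elim
      · change b = (x t).root at h
        exact ⟨t, by rw [h]⟩
    · refine ((((x s).finite_nbrs a).image fun b =>
        (some ⟨s, b⟩ : Option (Σ s, (x s).V))).union (Set.finite_singleton none)).subset ?_
      rintro (_ | ⟨t, b⟩) h
      · exact Or.inr rfl
      · obtain ⟨h1, h2⟩ := h
        dsimp only at h1
        subst h1
        exact Or.inl ⟨b, h2, rfl⟩
  root := none
  label
    | none => i
    | some a => (x a.1).label a.2

/-- `graftTree` on isomorphism classes; it does not depend on the representatives. -/
noncomputable def graft {ι : Type} [Finite ι] (i : Fin n) (x : ι → Tn n) : Tn n :=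
  ⟦graftTree i fun s => (x s).out⟧

/-! ### Multi-type Galton-Watson measures -/

/-- The data of a multi-type Galton-Watson measure with types in `Fin n`: the law of the type of
the root, and, for each type `i`, the law of the vector whose `j`-th entry is the number of
children of type `j` of an individual of type `i`. -/
structure GW (n : ℕ) where
  rootType : PMF (Fin n)
  offspring : Fin n → PMF (Fin n → ℕ)

namespace GW

/-- The law of the Galton-Watson tree whose root has type `i`: the offspring vectors of all
individuals are independent, with the law prescribed by the type of the individual. -/
noncomputable def lawFrom (ν : GW n) (i : Fin n) : Measure (Tn n) :=
  (Measure.infinitePi fun u : List (Fin n × ℕ) => (ν.offspring (indType i u)).toMeasure).map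
    fun ω => (⟦familyTree i ω⟧ : Tn n)

/-- The Galton-Watson measure, as a measure on rooted labelled trees. -/
noncomputable def law (ν : GW n) : Measure (Tn n) := ∑ i, ν.rootType i • ν.lawFrom i

/-- Every type is the type of the root with positive probability, and, given that the root has
type `i`, the tree has a vertex of type `j` with positive probability. -/
def StronglyConnected (ν : GW n) : Prop :=
  ∀ i j, 0 < ν.law (N i) ∧ 0 < ProbabilityTheory.cond ν.law (N i) {t | HasLabel j t}

/-- The law of the tree whose root has label `i` and `c j` neighbours with label `j` for each `j`,
the descendant subtrees of the neighbours being independent Galton-Watson trees, where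
the type of a vertex is its label. -/
noncomputable def graftLaw (ν : GW n) (i : Fin n) (c : Fin n → ℕ) : Measure (Tn n) :=
  (Measure.pi fun s : (Σ j, Fin (c j)) => ν.lawFrom s.1).map (graft i)

/-- Conditioned on the labels of the root and of its neighbours, the descendant subtrees of the
neighbours of the root are, under `μ`, independent Galton-Watson trees with the offspring laws
of `ν`, where the type of a vertex is its label. -/
def Describes (ν : GW n) (μ : Measure (Tn n)) : Prop :=
  ∀ i c, μ (Nc i c) ≠ 0 → ProbabilityTheory.cond μ (Nc i c) = ν.graftLaw i c

end GW

/-! ### Neighbour laws -/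

/-- `σ` conditioned on the root having label `i`, seen as a law on the vectors that count the
neighbours of the root by their label. -/
noncomputable def nbrLaw (σ : Measure (Tn n)) (i : Fin n) : Measure (Fin n → ℕ) :=
  (ProbabilityTheory.cond σ (N i)).map nbrCount

/-- The vectors `c` with `∑ j, c j = d`. -/
def ofSize (d : ℕ) : Set (Fin n → ℕ) := {c | ∑ j, c j = d}

/-- The set of all `d` such that some vector of size `d` has positive probability. -/
def D (ρ : Measure (Fin n → ℕ)) : Set ℕ := {d | ∃ c ∈ ofSize d, 0 < ρ {c}}

/-- The law `ρ` charges vectors of size `d` with the multinomial probabilities with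
parameters `p`. -/
def MultinomialOn (ρ : Measure (Fin n → ℕ)) (d : ℕ) (p : Fin n → ℝ) : Prop :=
  ∀ c ∈ ofSize d, ρ {c} = ENNReal.ofReal (Nat.multinomial Finset.univ c * ∏ k, p k ^ c k)

/-- The rows of `p` are probability vectors and, given that the root has type `i` and `d`
children, the vector counting its children by type is multinomial with parameters `p i`,
for all `i` and all possible `d`. -/
def HasMultinomialOffspring (ν : GW n) (p : Fin n → Fin n → ℝ) : Prop :=
  (∀ i j, 0 ≤ p i j) ∧ (∀ i, ∑ j, p i j = 1) ∧
  ∀ i, ∀ d ∈ D (nbrLaw ν.law i),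
    MultinomialOn (ProbabilityTheory.cond (nbrLaw ν.law i) (ofSize d)) d (p i)

/-- The product of `p a b / p b a` over the steps from `a` to `b` of any closed walk along which
`p a b` is positive is `1`. (If some `p b a` is `0` then the product is `0` in Lean, so
that the condition fails.) -/
def CycleCondition (p : Fin n → Fin n → ℝ) : Prop :=
  ∀ (m : ℕ) (i : ℕ → Fin n), i m = i 0 → (∀ s < m, 0 < p (i s) (i (s + 1))) →
    ∏ s ∈ Finset.range m, p (i s) (i (s + 1)) / p (i (s + 1)) (i s) = 1

/-- The system of equations for the law `w` of the label of the root. -/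
def RootEquations (p : Fin n → Fin n → ℝ) (w : Fin n → ℝ) : Prop :=
  (∀ i j, 0 < p i j → w i / w j = p j i / p i j) ∧ ∑ k, w k = 1

/-- `μ` is a reversible probability measure for simple random walk that is described by `ν`. -/
def IsReversibleFor (ν : GW n) (μ : Measure (Tn n)) : Prop :=
  IsProbabilityMeasure μ ∧ Reversible μ ∧ ν.Describes μ

end GWTree

/-!
Write `q i c` for the probability that an individual of type `i` has offspring `c`, and `e j` for
the vector counting one element of type `j`.

*Flow across an edge.* If `μ` is described by `ν`, then the tree seen by the walk along a step from
a root of type `i` with neighbours `d + e j` to a neighbour of type `j` consists of two grafts of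
independent Galton-Watson trees joined by an edge: one at the root, with the `d` other neighbours,
and one at the new root, with offspring `c` of law `q j`. Hence the flow of the walk from `A` to `B`
is the sum over `i`, `j`, `c`, `d` of `edgeMass μ i j d * q j c * joinProb i j d c A B`
(`GW.Describes.flow`), where `joinProb` is invariant under exchanging the two ends of the edge. This
rests on the branching property of the Galton-Watson law (`GW.lawFrom_apply`) and on the fact that
rerooting a graft at a piece which is itself a graft exchanges the two (`rerootGraft_cons`).

*Reversibility in terms of edges.* For the sets `Nc i (d + e j)` and `Nc j (c + e i)` the flow has a
single term, and reversibility reads `edgeMass i j d * q j c = edgeMass j i c * q i d`. So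
`edgeMass i j d = flux i j * q i d` with a symmetric matrix `flux` whose rows sum to `μ (N i)`
(`IsReversibleFor.edgeMass_eq`). Conversely, this factorization implies reversibility for all sets
(`GW.Describes.reversible`).

*Consequences.* With `p i j = flux i j / μ (N i)`, counting in two ways the vectors
`d + e j + e k` gives `(d j + 1) q i (d + e j) p i k = (d k + 1) q i (d + e k) p i j`, which forces
`q i` to be multinomial for each number of children (`exists_eq_mul_multi`). Symmetry of `flux` is
detailed balance for `p` and `μ (N i)`; it gives the cycle condition and the equations for the law
of the label of the root. By strong connectivity `p` and then the law of the label of the root are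
determined, hence `flux`, hence `edgeMass` and `μ`.

*Existence.* The cycle condition yields weights `w` in detailed balance with `p`
(`CycleCondition.exists_weights`). The measure for which a root of type `i` has law `w i`, and its
neighbours are distributed as its children with one more neighbour added, has
`edgeMass i j d = w i * p i j * q i d` (`GW.edgeMass_reversibleMeasure`), by the multinomial form.

*Measurability.* The first `h` levels of a tree have countably many isomorphism types, so a set
described by finitely many levels is measurable. To handle these levels, isomorphisms of balls are
represented by pairs of total maps (`LTree.BallMaps`), which makes restriction to fewer levels and
rerooting immediate.
-/

namespace GWTree

variable {n : ℕ}

/-! ### Balls and partial isomorphisms -/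

theorem exists_adj_dist_le {V : Type} {G : SimpleGraph V} (hG : G.Connected) {a b : V} {k : ℕ}
    (h : G.dist a b ≤ k + 1) : a = b ∨ ∃ c, G.Adj a c ∧ G.dist c b ≤ k := by
  obtain ⟨w, hw⟩ := hG.exists_walk_length_eq_dist a b
  cases w with
  | nil => exact Or.inl rfl
  | cons hac q =>
    refine Or.inr ⟨_, hac, ?_⟩
    have := SimpleGraph.dist_le q
    simp only [SimpleGraph.Walk.length_cons] at hw
    omega

/-- A function that grows by at most one along every edge grows by at most the graph distance. -/
theorem le_add_dist {V : Type} {G : SimpleGraph V} (hG : G.Connected) {l : V → ℕ}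
    (hl : ∀ a b, G.Adj a b → l b ≤ l a + 1) (a b : V) : l b ≤ l a + G.dist a b := by
  obtain ⟨w, hw⟩ := hG.exists_walk_length_eq_dist a b
  rw [← hw]
  clear hw
  induction w with
  | nil => simp
  | cons h q ih =>
    simp only [SimpleGraph.Walk.length_cons]
    have := hl _ _ h
    omega

namespace LTree

theorem dist_le_succ_of_adj (T : LTree n) {a b : T.V} (h : T.G.Adj a b) :
    T.G.dist T.root b ≤ T.G.dist T.root a + 1 := by
  have h1 := T.isTree.connected.dist_triangle (u := T.root) (v := a) (w := b)
  rw [SimpleGraph.dist_eq_one_iff_adj.2 h] at h1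
  exact h1

/-- A map of vertices that restricts to a morphism of rooted labelled trees from the first `h`
levels of `S` to `T`. -/
structure BallHom (h : ℕ) (S T : LTree n) (f : S.V → T.V) : Prop where
  root : f S.root = T.root
  label : ∀ v ∈ S.ball h, T.label (f v) = S.label v
  adj : ∀ u ∈ S.ball h, ∀ v ∈ S.ball h, S.G.Adj u v → T.G.Adj (f u) (f v)

/-- Mutually inverse morphisms between the first `h` levels of `S` and of `T`, given as total maps
whose values outside of the balls are irrelevant. -/
structure BallMaps (h : ℕ) (S T : LTree n) (f : S.V → T.V) (g : T.V → S.V) : Prop where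
  left : BallHom h S T f
  right : BallHom h T S g
  left_inv : ∀ v ∈ S.ball h, g (f v) = v
  right_inv : ∀ v ∈ T.ball h, f (g v) = v

/-- Near the root a morphism does not increase distances, because geodesics that start at `a` and
have length at most `k` stay in the ball on which it is defined. -/
theorem BallHom.dist_le {h : ℕ} {S T : LTree n} {f : S.V → T.V} (hf : BallHom h S T f)
    {k : ℕ} : ∀ {a b : S.V}, S.G.dist S.root a + k ≤ h → S.G.dist a b ≤ k →
      T.G.dist (f a) (f b) ≤ k := by
  induction k with
  | zero =>
    intro a b _ hab
    have : a = b := by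
      rw [← S.isTree.connected.dist_eq_zero_iff]; omega
    simp [this]
  | succ k ih =>
    intro a b ha hab
    rcases exists_adj_dist_le S.isTree.connected hab with rfl | ⟨c, hac, hcb⟩
    · simp
    · have hc := S.dist_le_succ_of_adj hac
      have h1 := ih (a := c) (b := b) (by omega) hcb
      have h2 : T.G.Adj (f a) (f c) :=
        hf.adj a (by change _ ≤ h; omega) c (by change _ ≤ h; omega) hac
      have h3 := T.isTree.connected.dist_triangle (u := f a) (v := f c) (w := f b)
      rw [SimpleGraph.dist_eq_one_iff_adj.2 h2] at h3
      omega

theorem BallHom.mem_ball {h k : ℕ} {S T : LTree n} {f : S.V → T.V} (hf : BallHom h S T f)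
    (hk : k ≤ h) {v : S.V} (hv : v ∈ S.ball k) : f v ∈ T.ball k := by
  change T.G.dist T.root (f v) ≤ k
  rw [← hf.root]
  exact hf.dist_le (by simpa using hk) hv

theorem ball_mono (T : LTree n) {h k : ℕ} (hk : h ≤ k) : T.ball h ⊆ T.ball k :=
  fun _ hv => le_trans (α := ℕ) hv hk

theorem BallHom.mono {h k : ℕ} (hk : h ≤ k) {S T : LTree n} {f : S.V → T.V}
    (hf : BallHom k S T f) : BallHom h S T f :=
  ⟨hf.root, fun v hv => hf.label v (S.ball_mono hk hv),
    fun u hu v hv => hf.adj u (S.ball_mono hk hu) v (S.ball_mono hk hv)⟩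

theorem BallMaps.mono {h k : ℕ} (hk : h ≤ k) {S T : LTree n} {f : S.V → T.V} {g : T.V → S.V}
    (H : BallMaps k S T f g) : BallMaps h S T f g :=
  ⟨H.left.mono hk, H.right.mono hk, fun v hv => H.left_inv v (S.ball_mono hk hv),
    fun v hv => H.right_inv v (T.ball_mono hk hv)⟩

theorem BallMaps.symm {h : ℕ} {S T : LTree n} {f : S.V → T.V} {g : T.V → S.V}
    (H : BallMaps h S T f g) : BallMaps h T S g f :=
  ⟨H.right, H.left, H.right_inv, H.left_inv⟩

theorem BallHom.comp {h : ℕ} {S T U : LTree n} {f : S.V → T.V} {f' : T.V → U.V}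
    (hf : BallHom h S T f) (hf' : BallHom h T U f') : BallHom h S U (f' ∘ f) where
  root := by simp [hf.root, hf'.root]
  label v hv := by
    rw [Function.comp, hf'.label _ (hf.mem_ball le_rfl hv), hf.label v hv]
  adj u hu v hv huv :=
    hf'.adj _ (hf.mem_ball le_rfl hu) _ (hf.mem_ball le_rfl hv) (hf.adj u hu v hv huv)

theorem BallMaps.trans {h : ℕ} {S T U : LTree n} {f : S.V → T.V} {g : T.V → S.V}
    {f' : T.V → U.V} {g' : U.V → T.V} (H : BallMaps h S T f g) (H' : BallMaps h T U f' g') :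
    BallMaps h S U (f' ∘ f) (g ∘ g') where
  left := H.left.comp H'.left
  right := H'.right.comp H.right
  left_inv v hv := by
    simp only [Function.comp]
    rw [H'.left_inv _ (H.left.mem_ball le_rfl hv), H.left_inv v hv]
  right_inv v hv := by
    simp only [Function.comp]
    rw [H.right_inv _ (H'.right.mem_ball le_rfl hv), H'.right_inv v hv]

theorem BallMaps.refl (h : ℕ) (S : LTree n) : BallMaps h S S id id :=
  ⟨⟨rfl, fun _ _ => rfl, fun _ _ _ _ h => h⟩, ⟨rfl, fun _ _ => rfl, fun _ _ _ _ h => h⟩,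
    fun _ _ => rfl, fun _ _ => rfl⟩

theorem ballEquiv_iff {h : ℕ} {S T : LTree n} :
    BallEquiv h S T ↔ ∃ f g, BallMaps h S T f g := by
  classical
  constructor
  · rintro ⟨φ, hr, hl⟩
    refine ⟨fun v => if hv : v ∈ S.ball h then (φ ⟨v, hv⟩).1 else T.root,
      fun v => if hv : v ∈ T.ball h then (φ.symm ⟨v, hv⟩).1 else S.root, ⟨?_, ?_, ?_⟩,
      ⟨?_, ?_, ?_⟩, ?_, ?_⟩
    · rw [dif_pos (S.root_mem_ball h), hr]
    · intro v hv
      rw [dif_pos hv]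
      exact hl ⟨v, hv⟩
    · intro u hu v hv huv
      rw [dif_pos hu, dif_pos hv]
      exact φ.map_adj_iff.2 (show (S.G.induce (S.ball h)).Adj ⟨u, hu⟩ ⟨v, hv⟩ from huv)
    · rw [dif_pos (T.root_mem_ball h), ← hr, φ.symm_apply_apply]
    · intro v hv
      rw [dif_pos hv, ← hl, φ.apply_symm_apply]
    · intro u hu v hv huv
      rw [dif_pos hu, dif_pos hv]
      exact φ.symm.map_adj_iff.2 (show (T.G.induce (T.ball h)).Adj ⟨u, hu⟩ ⟨v, hv⟩ from huv)
    · intro v hv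
      simp [hv]
    · intro v hv
      simp [hv]
  · rintro ⟨f, g, H⟩
    refine ⟨⟨⟨fun v => ⟨f v, H.left.mem_ball le_rfl v.2⟩,
      fun v => ⟨g v, H.right.mem_ball le_rfl v.2⟩, fun v => Subtype.ext (H.left_inv v v.2),
      fun v => Subtype.ext (H.right_inv v v.2)⟩, ?_⟩, ?_, ?_⟩
    · rintro ⟨u, hu⟩ ⟨v, hv⟩
      change T.G.Adj (f u) (f v) ↔ S.G.Adj u v
      refine ⟨fun huv => ?_, H.left.adj u hu v hv⟩
      have := H.right.adj _ (H.left.mem_ball le_rfl hu) _ (H.left.mem_ball le_rfl hv) huv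
      rwa [H.left_inv u hu, H.left_inv v hv] at this
    · exact Subtype.ext H.left.root
    · exact fun v => H.left.label v v.2

theorem Equiv.ballEquiv {S T : LTree n} (e : Equiv S T) (h : ℕ) : BallEquiv h S T := by
  obtain ⟨φ, hr, hl⟩ := e
  refine ballEquiv_iff.2 ⟨φ, φ.symm, ⟨hr, fun v _ => hl v, fun u _ v _ => φ.map_adj_iff.2⟩,
    ⟨?_, fun v _ => ?_, fun u _ v _ => φ.symm.map_adj_iff.2⟩, fun v _ => by simp,
    fun v _ => by simp⟩
  · rw [← hr, φ.symm_apply_apply]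
  · rw [← hl, φ.apply_symm_apply]

theorem BallEquiv.refl (h : ℕ) (S : LTree n) : BallEquiv h S S :=
  ballEquiv_iff.2 ⟨_, _, BallMaps.refl h S⟩

theorem BallEquiv.symm {h : ℕ} {S T : LTree n} (H : BallEquiv h S T) : BallEquiv h T S := by
  obtain ⟨f, g, H⟩ := ballEquiv_iff.1 H
  exact ballEquiv_iff.2 ⟨g, f, H.symm⟩

theorem BallEquiv.trans {h : ℕ} {S T U : LTree n} (H : BallEquiv h S T) (H' : BallEquiv h T U) :
    BallEquiv h S U := by
  obtain ⟨f, g, H⟩ := ballEquiv_iff.1 H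
  obtain ⟨f', g', H'⟩ := ballEquiv_iff.1 H'
  exact ballEquiv_iff.2 ⟨_, _, H.trans H'⟩

theorem BallEquiv.mono {h k : ℕ} (hk : h ≤ k) {S T : LTree n} (H : BallEquiv k S T) :
    BallEquiv h S T := by
  obtain ⟨f, g, H⟩ := ballEquiv_iff.1 H
  exact ballEquiv_iff.2 ⟨f, g, H.mono hk⟩

theorem mem_ball_one_of_adj (S : LTree n) {v : S.V} (hv : S.G.Adj S.root v) : v ∈ S.ball 1 :=
  (SimpleGraph.dist_eq_one_iff_adj.2 hv).le

theorem ball_reroot_subset (S : LTree n) {v : S.V} (hv : S.G.Adj S.root v) (h : ℕ) :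
    (S.reroot v).ball h ⊆ S.ball (h + 1) := by
  intro u hu
  have h3 := S.isTree.connected.dist_triangle (u := S.root) (v := v) (w := u)
  rw [SimpleGraph.dist_eq_one_iff_adj.2 hv] at h3
  change S.G.dist v u ≤ h at hu
  change S.G.dist S.root u ≤ h + 1
  omega

/-- Maps between the first `h + 1` levels restrict to the first `h` levels seen from a neighbour of
the root. -/
theorem BallMaps.reroot {h : ℕ} {S T : LTree n} {f : S.V → T.V} {g : T.V → S.V}
    (H : BallMaps (h + 1) S T f g) {v : S.V} (hv : S.G.Adj S.root v) :
    BallMaps h (S.reroot v) (T.reroot (f v)) f g := by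
  have hv1 : v ∈ S.ball (h + 1) := S.ball_mono (by omega) (S.mem_ball_one_of_adj hv)
  have hfv : T.G.Adj T.root (f v) := by
    rw [← H.left.root]
    exact H.left.adj _ (S.root_mem_ball _) _ hv1 hv
  have hS := S.ball_reroot_subset hv h
  have hT := T.ball_reroot_subset hfv h
  exact ⟨⟨rfl, fun u hu => H.left.label u (hS hu),
    fun u hu w hw => H.left.adj u (hS hu) w (hS hw)⟩,
    ⟨H.left_inv v hv1, fun u hu => H.right.label u (hT hu),
    fun u hu w hw => H.right.adj u (hT hu) w (hT hw)⟩,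
    fun u hu => H.left_inv u (hS hu), fun u hu => H.right_inv u (hT hu)⟩

theorem ball_finite (T : LTree n) (h : ℕ) : (T.ball h).Finite := by
  induction h with
  | zero =>
    refine (Set.finite_singleton T.root).subset fun v hv => ?_
    have : T.G.dist T.root v = 0 := Nat.le_zero.1 hv
    exact (T.isTree.connected.dist_eq_zero_iff.1 this).symm
  | succ h ih =>
    refine ((ih.biUnion fun v _ => T.finite_nbrs v).union (Set.finite_singleton T.root)).subset ?_
    intro v hv
    rcases exists_adj_dist_le T.isTree.connected
      (by rw [SimpleGraph.dist_comm]; exact hv : T.G.dist v T.root ≤ h + 1) with rfl | ⟨c, hc, hd⟩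
    · exact Or.inr rfl
    · refine Or.inl (Set.mem_biUnion (x := c) ?_ hc.symm)
      change T.G.dist T.root c ≤ h
      rwa [SimpleGraph.dist_comm]

end LTree

/-! ### Grafts, up to isomorphism and up to the first levels -/

section graft

variable {ι κ : Type}

theorem graftGraph_adj_root (x : ι → LTree n) (s : ι) :
    (graftGraph x).Adj none (some ⟨s, (x s).root⟩) := rfl

/-- Isomorphic families of trees, possibly with different index sets, have isomorphic grafts. The
isomorphism respects the roots of the pieces. -/
theorem exists_graftTree_iso [Finite ι] [Finite κ] (i : Fin n) {x : ι → LTree n}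
    {y : κ → LTree n} (e : ι ≃ κ) (H : ∀ s, LTree.Equiv (x s) (y (e s))) :
    ∃ φ : (graftTree i x).G ≃g (graftTree i y).G, φ none = none ∧
      (∀ v, (graftTree i y).label (φ v) = (graftTree i x).label v) ∧
      ∀ s, φ (some ⟨s, (x s).root⟩) = some ⟨e s, (y (e s)).root⟩ := by
  choose φ hr hl using H
  let F : Option (Σ s, (x s).V) ≃ Option (Σ s, (y s).V) :=
    _root_.Equiv.optionCongr (_root_.Equiv.sigmaCongr e fun s => (φ s).toEquiv)
  have hF0 : F none = none := rfl
  have hF : ∀ s a, F (some ⟨s, a⟩) = some ⟨e s, φ s a⟩ := fun s a => rfl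
  refine ⟨⟨F, ?_⟩, hF0, ?_, ?_⟩
  · rintro (_ | ⟨s, a⟩) (_ | ⟨t, b⟩)
    · exact Iff.rfl
    · change φ t b = (y (e t)).root ↔ b = (x t).root
      rw [← hr, (φ t).injective.eq_iff]
    · change φ s a = (y (e s)).root ↔ a = (x s).root
      rw [← hr, (φ s).injective.eq_iff]
    · change (graftGraph y).Adj (some ⟨e s, φ s a⟩) (some ⟨e t, φ t b⟩) ↔ _
      constructor
      · rintro ⟨h1, h2⟩
        have hst : s = t := e.injective h1
        subst hst
        exact ⟨rfl, (φ s).map_adj_iff.1 h2⟩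
      · rintro ⟨h1, h2⟩
        dsimp only at h1
        subst h1
        exact ⟨rfl, (φ s).map_adj_iff.2 h2⟩
  · rintro (_ | ⟨s, a⟩)
    · rfl
    · exact hl s a
  · intro s
    exact congrArg (fun b => (some ⟨e s, b⟩ : Option (Σ s, (y s).V))) (hr s)

theorem graftTree_ball_succ [Finite ι] (i : Fin n) (x : ι → LTree n) {h : ℕ} {s : ι}
    {a : (x s).V} (ha : (some ⟨s, a⟩ : Option (Σ s, (x s).V)) ∈ (graftTree i x).ball (h + 1)) :
    a ∈ (x s).ball h := by
  let l : Option (Σ s, (x s).V) → ℕ := fun v =>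
    v.elim 0 fun b => (x b.1).G.dist (x b.1).root b.2 + 1
  have := le_add_dist (graftTree i x).isTree.connected (l := l) (by
    rintro (_ | ⟨s, a⟩) (_ | ⟨t, b⟩) hab
    · simp
    · change b = (x t).root at hab
      subst hab
      simp [l]
    · simp [l]
    · obtain ⟨h1, h2⟩ := hab
      dsimp only at h1
      subst h1
      have := (x s).dist_le_succ_of_adj h2
      exact Nat.succ_le_succ this) none (some ⟨s, a⟩)
  change (graftTree i x).G.dist none _ ≤ h + 1 at ha
  change (x s).G.dist (x s).root a ≤ h
  simp only [l, Option.elim] at this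
  omega

theorem graftTree_ballMaps [Finite ι] (i : Fin n) {x y : ι → LTree n} {h : ℕ}
    {f : ∀ s, (x s).V → (y s).V} {g : ∀ s, (y s).V → (x s).V}
    (H : ∀ s, LTree.BallMaps h (x s) (y s) (f s) (g s)) :
    LTree.BallMaps (h + 1) (graftTree i x) (graftTree i y)
      (Option.map (Sigma.map id f)) (Option.map (Sigma.map id g)) := by
  have key : ∀ {x y : ι → LTree n} {f : ∀ s, (x s).V → (y s).V},
      (∀ s, LTree.BallHom h (x s) (y s) (f s)) → LTree.BallHom (h + 1) (graftTree i x)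
        (graftTree i y) (Option.map (Sigma.map id f)) := by
    intro x y f H
    refine ⟨rfl, ?_, ?_⟩
    · rintro (_ | ⟨s, a⟩) hv
      · rfl
      · exact (H s).label a (graftTree_ball_succ i x hv)
    · rintro (_ | ⟨s, a⟩) hu (_ | ⟨t, b⟩) hv huv
      · exact huv.elim
      · change b = (x t).root at huv
        subst huv
        exact (H t).root
      · change a = (x s).root at huv
        subst huv
        exact (H s).root
      · obtain ⟨h1, h2⟩ := huv
        dsimp only at h1
        subst h1
        exact ⟨rfl, (H s).adj a (graftTree_ball_succ i x hu) b (graftTree_ball_succ i x hv) h2⟩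
  refine ⟨key fun s => (H s).left, key fun s => (H s).right, ?_, ?_⟩
  · rintro (_ | ⟨s, a⟩) hv
    · rfl
    · have := (H s).left_inv a (graftTree_ball_succ i x hv)
      exact congrArg (fun b => (some ⟨s, b⟩ : Option (Σ s, (x s).V))) this
  · rintro (_ | ⟨s, a⟩) hv
    · rfl
    · have := (H s).right_inv a (graftTree_ball_succ i y hv)
      exact congrArg (fun b => (some ⟨s, b⟩ : Option (Σ s, (y s).V))) this

theorem graftTree_ballEquiv [Finite ι] (i : Fin n) {x y : ι → LTree n} {h : ℕ}
    (H : ∀ s, LTree.BallEquiv h (x s) (y s)) :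
    LTree.BallEquiv (h + 1) (graftTree i x) (graftTree i y) := by
  choose f g H using fun s => LTree.ballEquiv_iff.1 (H s)
  exact LTree.ballEquiv_iff.2 ⟨_, _, graftTree_ballMaps i H⟩

theorem graftTree_reroot_ballEquiv [Finite ι] (i : Fin n) {x y : ι → LTree n} {h : ℕ}
    (H : ∀ s, LTree.BallEquiv h (x s) (y s)) (s : ι) :
    LTree.BallEquiv h ((graftTree i x).reroot (some ⟨s, (x s).root⟩))
      ((graftTree i y).reroot (some ⟨s, (y s).root⟩)) := by
  choose f g H using fun s => LTree.ballEquiv_iff.1 (H s)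
  have := (graftTree_ballMaps i H).reroot (graftGraph_adj_root x s)
  have hs : Option.map (Sigma.map id f) (some ⟨s, (x s).root⟩) = some ⟨s, (y s).root⟩ :=
    congrArg (fun b => (some ⟨s, b⟩ : Option (Σ s, (y s).V))) (H s).left.root
  rw [hs] at this
  exact LTree.ballEquiv_iff.2 ⟨Option.map (Sigma.map id f), Option.map (Sigma.map id g), this⟩

/-- The vertices of two grafts joined by an edge, when the second one is a piece of the first, are
sent to the vertices of the tree in which the first one is a piece of the second. -/
def doubleGraftMap (i j : Fin n) (x : ι → LTree n) (y : κ → LTree n) [Finite ι] [Finite κ] :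
    Option (Σ o : Option ι, (o.elim (graftTree j y) x).V) →
      Option (Σ o : Option κ, (o.elim (graftTree i x) y).V)
  | none => some ⟨none, none⟩
  | some ⟨some s, a⟩ => some ⟨none, some ⟨s, a⟩⟩
  | some ⟨none, none⟩ => none
  | some ⟨none, some ⟨t, b⟩⟩ => some ⟨some t, b⟩

theorem doubleGraftMap_involutive [Finite ι] [Finite κ] (i j : Fin n) (x : ι → LTree n)
    (y : κ → LTree n) (v) : doubleGraftMap j i y x (doubleGraftMap i j x y v) = v := by
  rcases v with _ | ⟨_ | s, v⟩
  · rfl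
  · rcases v with _ | ⟨t, b⟩ <;> rfl
  · rfl

theorem doubleGraftMap_adj [Finite ι] [Finite κ] (i j : Fin n) (x : ι → LTree n)
    (y : κ → LTree n) (u v)
    (huv : (graftGraph fun o : Option ι => o.elim (graftTree j y) x).Adj u v) :
    (graftGraph fun o : Option κ => o.elim (graftTree i x) y).Adj (doubleGraftMap i j x y u)
      (doubleGraftMap i j x y v) := by
  have h1 : ∀ v : Option (Σ o : Option ι, (o.elim (graftTree j y) x).V),
      (graftGraph fun o : Option ι => o.elim (graftTree j y) x).Adj none v →
      (graftGraph fun o : Option κ => o.elim (graftTree i x) y).Adj (some ⟨none, none⟩)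
        (doubleGraftMap i j x y v) := by
    rintro (_ | ⟨_ | t, b⟩) h
    · exact h.elim
    · have hb : b = none := h
      subst hb
      rfl
    · have hb : b = (x t).root := h
      subst hb
      exact ⟨rfl, rfl⟩
  rcases u with _ | ⟨s, a⟩
  · exact h1 v huv
  rcases v with _ | ⟨t, b⟩
  · exact (h1 _ huv.symm).symm
  obtain ⟨hst, hab⟩ := huv
  dsimp only at hst
  subst hst
  rcases s with _ | s
  · rcases a with _ | ⟨s, a⟩ <;> rcases b with _ | ⟨t, b⟩
    · exact hab.elim
    · exact hab
    · exact hab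
    · obtain ⟨hst, hab⟩ := hab
      dsimp only at hst
      subst hst
      exact ⟨rfl, hab⟩
  · exact ⟨rfl, rfl, hab⟩

/-- Two grafts joined by an edge, rooted at either end of that edge: rerooting the graft in which
one piece is itself a graft exchanges the roles of the two graft vertices. -/
theorem graftTree_double [Finite ι] [Finite κ] (i j : Fin n) (x : ι → LTree n) (y : κ → LTree n) :
    LTree.Equiv ((graftTree i fun o : Option ι => o.elim (graftTree j y) x).reroot
      (some ⟨none, none⟩)) (graftTree j fun o : Option κ => o.elim (graftTree i x) y) := by
  refine ⟨⟨⟨doubleGraftMap i j x y, doubleGraftMap j i y x, doubleGraftMap_involutive i j x y,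
    doubleGraftMap_involutive j i y x⟩, fun {u v} => ⟨fun h => ?_, doubleGraftMap_adj i j x y u v⟩⟩,
    rfl, ?_⟩
  · have key : ∀ u v, (graftGraph fun o : Option κ => o.elim (graftTree i x) y).Adj
        (doubleGraftMap i j x y u) (doubleGraftMap i j x y v) →
        (graftGraph fun o : Option ι => o.elim (graftTree j y) x).Adj u v := by
      intro u v h
      have := doubleGraftMap_adj j i y x _ _ h
      rwa [doubleGraftMap_involutive, doubleGraftMap_involutive] at this
    exact key u v h
  · rintro (_ | ⟨_ | s, v⟩)
    · rfl
    · rcases v with _ | ⟨t, b⟩ <;> rfl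
    · rfl

end graft

/-! ### Family trees -/

theorem length_le_of_mem_ball (i : Fin n) (ω : List (Fin n × ℕ) → Fin n → ℕ) {h : ℕ}
    {u : {u // Born ω u}} (hu : u ∈ (familyTree i ω).ball h) : u.1.length ≤ h := by
  have := le_add_dist (familyTree i ω).isTree.connected
    (l := fun u : {u // Born ω u} => u.1.length) (by
      rintro u v (⟨x, h⟩ | ⟨x, h⟩) <;> rw [h] <;> simp only [List.length_cons] <;> omega)
    ⟨[], trivial⟩ u
  change (familyTree i ω).G.dist ⟨[], trivial⟩ u ≤ h at hu
  simp only [List.length_nil] at this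
  omega

/-- The first levels of a family tree only depend on the individuals born in the corresponding
generations. -/
theorem familyTree_ballEquiv (i : Fin n) {ω ω' : List (Fin n × ℕ) → Fin n → ℕ} {h : ℕ}
    (H : ∀ u : List (Fin n × ℕ), u.length ≤ h → (Born ω u ↔ Born ω' u)) :
    LTree.BallEquiv h (familyTree i ω) (familyTree i ω') := by
  classical
  let f : ∀ ω ω' : List (Fin n × ℕ) → Fin n → ℕ, {u // Born ω u} → {u // Born ω' u} :=
    fun ω ω' u => if hu : Born ω' u.1 then ⟨u.1, hu⟩ else ⟨[], trivial⟩
  have hf : ∀ ω ω' : List (Fin n × ℕ) → Fin n → ℕ,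
      (∀ u : List (Fin n × ℕ), u.length ≤ h → (Born ω u ↔ Born ω' u)) →
      ∀ u ∈ (familyTree i ω).ball h, (f ω ω' u).1 = u.1 := by
    intro ω ω' H u hu
    have : Born ω' u.1 := (H _ (length_le_of_mem_ball i ω hu)).1 u.2
    simp [f, this]
  have key : ∀ ω ω' : List (Fin n × ℕ) → Fin n → ℕ,
      (∀ u : List (Fin n × ℕ), u.length ≤ h → (Born ω u ↔ Born ω' u)) →
      LTree.BallHom h (familyTree i ω) (familyTree i ω') (f ω ω') := by
    intro ω ω' H
    refine ⟨Subtype.ext (hf ω ω' H _ (LTree.root_mem_ball _ _)), fun v hv => ?_,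
      fun u hu v hv huv => ?_⟩
    · change indType i (f ω ω' v).1 = indType i v.1
      rw [hf ω ω' H v hv]
    · change (∃ x, (f ω ω' v).1 = x :: (f ω ω' u).1) ∨ ∃ x, (f ω ω' u).1 = x :: (f ω ω' v).1
      rw [hf ω ω' H v hv, hf ω ω' H u hu]
      exact huv
  have H' : ∀ u : List (Fin n × ℕ), u.length ≤ h → (Born ω' u ↔ Born ω u) :=
    fun u hu => (H u hu).symm
  refine LTree.ballEquiv_iff.2 ⟨f ω ω', f ω' ω, key ω ω' H, key ω' ω H', fun v hv => ?_,
    fun v hv => ?_⟩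
  · have := (key ω ω' H).mem_ball le_rfl hv
    exact Subtype.ext ((hf ω' ω H' _ this).trans (hf ω ω' H _ hv))
  · have := (key ω' ω H').mem_ball le_rfl hv
    exact Subtype.ext ((hf ω ω' H _ this).trans (hf ω' ω H' _ hv))

theorem indType_append (i : Fin n) (u : List (Fin n × ℕ)) (s : Fin n × ℕ) :
    indType i (u ++ [s]) = indType s.1 u := by
  cases u <;> rfl

theorem born_append (ω : List (Fin n × ℕ) → Fin n → ℕ) (u : List (Fin n × ℕ)) (s : Fin n × ℕ) :
    Born ω (u ++ [s]) ↔ s.2 < ω [] s.1 ∧ Born (fun v => ω (v ++ [s])) u := by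
  induction u with
  | nil => simp [Born]
  | cons x u ih =>
    simp only [List.cons_append, Born, ih]
    tauto

/-- A family tree is obtained by grafting the family trees of the children of the root. -/
theorem familyTree_equiv_graftTree (i : Fin n) (ω : List (Fin n × ℕ) → Fin n → ℕ) (c : Fin n → ℕ)
    (hc : ω [] = c) : LTree.Equiv (graftTree i fun s : (Σ j, Fin (c j)) =>
      familyTree s.1 fun u => ω (u ++ [(s.1, (s.2 : ℕ))])) (familyTree i ω) := by
  subst hc
  let F : Option (Σ s : (Σ j, Fin (ω [] j)),
      {u // Born (fun u => ω (u ++ [(s.1, (s.2 : ℕ))])) u}) → {u // Born ω u} := fun v =>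
    match v with
    | none => ⟨[], trivial⟩
    | some ⟨s, u⟩ => ⟨u.1 ++ [(s.1, (s.2 : ℕ))], (born_append ω _ _).2 ⟨s.2.2, u.2⟩⟩
  have hs : ∀ {s t : (Σ j, Fin (ω [] j))}, (s.1, (s.2 : ℕ)) = (t.1, (t.2 : ℕ)) → s = t := by
    rintro ⟨j, m⟩ ⟨j', m'⟩ h
    simp only [Prod.mk.injEq] at h
    obtain ⟨rfl, h⟩ := h
    rw [Fin.ext h]
  -- The individuals descending from the child `s` are the lists ending with `s`.
  have hinj : Function.Injective F := by
    rintro (_ | ⟨s, u⟩) (_ | ⟨t, v⟩) h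
    · rfl
    · exact absurd (congrArg Subtype.val h) (by simp [F])
    · exact absurd (congrArg Subtype.val h) (by simp [F])
    · have h' : u.1 ++ [(s.1, (s.2 : ℕ))] = v.1 ++ [(t.1, (t.2 : ℕ))] := congrArg Subtype.val h
      obtain ⟨h1, h2⟩ := List.append_inj' h' rfl
      obtain rfl := hs (List.cons.inj h2).1
      rw [Subtype.ext h1]
  have hsurj : Function.Surjective F := by
    rintro ⟨v, hv⟩
    rcases List.eq_nil_or_concat v with rfl | ⟨u, s, rfl⟩
    · exact ⟨none, rfl⟩
    · have h := (born_append ω u s).1 (by simpa using hv)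
      exact ⟨some ⟨⟨s.1, s.2, h.1⟩, u, h.2⟩, Subtype.ext (by simp [F])⟩
  have hroot : ∀ (s : (Σ j, Fin (ω [] j)))
      (u : {u // Born (fun u => ω (u ++ [(s.1, (s.2 : ℕ))])) u}),
      ((∃ x, u.1 ++ [(s.1, (s.2 : ℕ))] = x :: []) ∨ ∃ x, [] = x :: (u.1 ++ [(s.1, (s.2 : ℕ))])) ↔
        u = ⟨[], trivial⟩ := by
    rintro s ⟨u, hu⟩
    rcases u with _ | ⟨x, u⟩ <;> simp [Subtype.ext_iff]
  have hadj : ∀ u v, (familyGraph ω).Adj (F u) (F v) ↔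
      (graftGraph fun s : (Σ j, Fin (ω [] j)) =>
        familyTree s.1 fun u => ω (u ++ [(s.1, (s.2 : ℕ))])).Adj u v := by
    rintro (_ | ⟨s, u⟩) (_ | ⟨t, v⟩)
    · exact iff_of_false (familyGraph ω).irrefl (fun h => h)
    · exact hroot t v
    · exact or_comm.trans (hroot s u)
    · constructor
      · intro h
        have hst : s = t := by
          apply hs
          have hl : ∀ (u v : List (Fin n × ℕ)) (a b x : Fin n × ℕ),
              v ++ [b] = x :: (u ++ [a]) → a = b := by
            intro u v a b x h
            rw [← List.cons_append] at h
            exact ((List.cons.inj (List.append_inj' h rfl).2).1).symm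
          rcases h with ⟨x, h⟩ | ⟨x, h⟩
          · exact hl _ _ _ _ x h
          · exact (hl _ _ _ _ x h).symm
        subst hst
        refine ⟨rfl, ?_⟩
        rcases h with ⟨x, h⟩ | ⟨x, h⟩
        · exact Or.inl ⟨x, (List.append_inj' h rfl).1⟩
        · exact Or.inr ⟨x, (List.append_inj' h rfl).1⟩
      · rintro ⟨hst, h⟩
        dsimp only at hst
        subst hst
        rcases h with ⟨x, h⟩ | ⟨x, h⟩
        · exact Or.inl ⟨x, congrArg (· ++ [(s.1, (s.2 : ℕ))]) h⟩
        · exact Or.inr ⟨x, congrArg (· ++ [(s.1, (s.2 : ℕ))]) h⟩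
  refine ⟨⟨_root_.Equiv.ofBijective F ⟨hinj, hsurj⟩, fun {u v} => hadj u v⟩, rfl, ?_⟩
  · rintro (_ | ⟨s, u⟩)
    · rfl
    · exact indType_append i u.1 _

/-! ### The types of the first levels and measurability -/

/-- Equality of the first `h` levels up to isomorphism, as an equivalence relation. -/
def ballSetoid (n h : ℕ) : Setoid (LTree n) :=
  ⟨LTree.BallEquiv h, LTree.BallEquiv.refl h, LTree.BallEquiv.symm, LTree.BallEquiv.trans⟩

/-- The isomorphism type of the first `h` levels. -/
def ballType (h : ℕ) : Tn n → Quotient (ballSetoid n h) :=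
  Quotient.lift (fun T => Quotient.mk (ballSetoid n h) T)
    fun _ _ e => Quotient.sound (s := ballSetoid n h) (LTree.Equiv.ballEquiv e h)

theorem ballType_mk_eq_iff {h : ℕ} {S T : LTree n} :
    ballType h (⟦S⟧ : Tn n) = ballType h ⟦T⟧ ↔ LTree.BallEquiv h S T :=
  ⟨fun e => Quotient.exact (s := ballSetoid n h) e,
    fun e => Quotient.sound (s := ballSetoid n h) e⟩

theorem ballType_eq_iff_out {h : ℕ} {s t : Tn n} :
    ballType h s = ballType h t ↔ LTree.BallEquiv h s.out t.out := by
  rw [← ballType_mk_eq_iff, Quotient.out_eq, Quotient.out_eq]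

theorem ballType_eq_mono {h k : ℕ} (hk : h ≤ k) {s t : Tn n} (e : ballType k s = ballType k t) :
    ballType h s = ballType h t :=
  ballType_eq_iff_out.2 ((ballType_eq_iff_out.1 e).mono hk)

/-- Balls are finite, so their isomorphism types are coded by graphs on `Fin k` with a root and
labels. -/
instance countable_ballType (h : ℕ) : Countable (Quotient (ballSetoid n h)) := by
  let Code := Σ k : ℕ, (Fin k → Fin k → Prop) × Fin k × (Fin k → Fin n)
  have H : ∀ T : LTree n, ∃ c : Code, ∃ e : T.ball h ≃ Fin c.1,
      (∀ u v, c.2.1 (e u) (e v) ↔ T.G.Adj u v) ∧ e ⟨T.root, T.root_mem_ball h⟩ = c.2.2.1 ∧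
      ∀ v, c.2.2.2 (e v) = T.label v := by
    intro T
    have := (T.ball_finite h).to_subtype
    let e := Finite.equivFin (T.ball h)
    exact ⟨⟨_, fun a b => T.G.Adj (e.symm a) (e.symm b), e ⟨T.root, T.root_mem_ball h⟩,
      fun a => T.label (e.symm a)⟩, e,
      fun u v => by simp only [e.symm_apply_apply], rfl, fun v => by simp only [e.symm_apply_apply]⟩
  choose code hcode using H
  have hinj : Function.Injective fun q : Quotient (ballSetoid n h) => code q.out := by
    intro q q' hq
    obtain ⟨e, he, hr, hl⟩ := hcode q.out
    obtain ⟨e', he', hr', hl'⟩ := hcode q'.out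
    dsimp only at hq
    generalize code q.out = c at *
    subst hq
    rw [← Quotient.out_eq q, ← Quotient.out_eq q']
    refine Quotient.sound (s := ballSetoid n h) ⟨⟨e.trans e'.symm, fun {u v} => ?_⟩, ?_, ?_⟩
    · change q'.out.G.Adj (e'.symm (e u)).1 (e'.symm (e v)).1 ↔ q.out.G.Adj u.1 v.1
      rw [← he, ← he', e'.apply_symm_apply, e'.apply_symm_apply]
    · change e'.symm (e _) = _
      rw [hr, ← hr', e'.symm_apply_apply]
    · intro v
      change q'.out.label (e'.symm (e v)).1 = _
      rw [← hl, ← hl', e'.apply_symm_apply]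
  exact hinj.countable

theorem generators_eq (n : ℕ) :
    {A : Set (Tn n) | ∃ (h : ℕ) (S : LTree n), A = Quotient.mk _ '' {T | LTree.BallEquiv h S T}} =
      {A | ∃ (h : ℕ) (q : Quotient (ballSetoid n h)), A = {t | ballType h t = q}} := by
  have key : ∀ (h : ℕ) (S : LTree n), (Quotient.mk _ '' {T | LTree.BallEquiv h S T} : Set (Tn n)) =
      {t | ballType h t = ballType h ⟦S⟧} := by
    intro h S
    ext t
    constructor
    · rintro ⟨T, hT, rfl⟩
      exact (ballType_mk_eq_iff.2 hT).symm
    · induction t using Quotient.inductionOn with | _ T => ?_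
      intro hT
      exact ⟨T, ballType_mk_eq_iff.1 (Eq.symm hT), rfl⟩
  ext A
  constructor
  · rintro ⟨h, S, rfl⟩
    exact ⟨h, _, key h S⟩
  · rintro ⟨h, q, rfl⟩
    induction q using Quotient.inductionOn with | _ S => ?_
    exact ⟨h, S, (key h S).symm⟩

theorem instMeasurableSpaceTn_eq (n : ℕ) : (instMeasurableSpaceTn : MeasurableSpace (Tn n)) =
    MeasurableSpace.generateFrom
      {A | ∃ (h : ℕ) (q : Quotient (ballSetoid n h)), A = {t | ballType h t = q}} := by
  rw [← generators_eq]
  rfl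

theorem isPiSystem_generators (n : ℕ) :
    IsPiSystem {A : Set (Tn n) | ∃ (h : ℕ) (q : Quotient (ballSetoid n h)),
      A = {t | ballType h t = q}} := by
  have key : ∀ (h k : ℕ), h ≤ k → ∀ (q : Quotient (ballSetoid n h)) (r : Quotient (ballSetoid n k)),
      ({t | ballType h t = q} ∩ {t | ballType k t = r}).Nonempty →
      {t | ballType h t = q} ∩ {t | ballType k t = r} = {t | ballType k t = r} := by
    rintro h k hk q r ⟨s, rfl, rfl⟩
    exact inter_eq_right.2 fun t ht => ballType_eq_mono hk ht
  rintro _ ⟨h, q, rfl⟩ _ ⟨k, r, rfl⟩ hne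
  rcases le_total h k with hk | hk
  · exact ⟨k, r, key h k hk q r hne⟩
  · rw [inter_comm] at hne ⊢
    exact ⟨h, q, key k h hk r q hne⟩

theorem measurableSet_ballType (h : ℕ) (q : Quotient (ballSetoid n h)) :
    MeasurableSet {t : Tn n | ballType h t = q} := by
  rw [instMeasurableSpaceTn_eq]
  exact MeasurableSpace.measurableSet_generateFrom ⟨h, q, rfl⟩

theorem measurable_of_ballType {α : Type*} [MeasurableSpace α] {f : α → Tn n}
    (hf : ∀ h (q : Quotient (ballSetoid n h)), MeasurableSet {a | ballType h (f a) = q}) :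
    Measurable f := by
  rw [instMeasurableSpaceTn_eq]
  refine measurable_generateFrom ?_
  rintro _ ⟨h, q, rfl⟩
  exact hf h q

/-- A union of fibres of a countably-valued map with measurable fibres is measurable. -/
theorem measurableSet_of_fibres {α Q : Type*} [MeasurableSpace α] [Countable Q] (F : α → Q)
    (hF : ∀ q, MeasurableSet {a | F a = q}) {s : Set α}
    (hs : ∀ a b, F a = F b → a ∈ s → b ∈ s) : MeasurableSet s := by
  have : s = ⋃ q ∈ F '' s, {a | F a = q} := by
    ext b
    simp only [mem_iUnion, mem_ofPred_eq, exists_prop, exists_eq_right']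
    exact ⟨fun hb => ⟨b, hb, rfl⟩, fun ⟨a, ha, hab⟩ => hs a b hab ha⟩
  rw [this]
  exact MeasurableSet.biUnion (Set.to_countable _) fun q _ => hF q

/-- Sets of trees described in terms of the first `h` levels are measurable. -/
theorem measurableSet_of_ballType (h : ℕ) {s : Set (Tn n)}
    (hs : ∀ S T : LTree n, LTree.BallEquiv h S T → (⟦S⟧ : Tn n) ∈ s → (⟦T⟧ : Tn n) ∈ s) :
    MeasurableSet s := by
  refine measurableSet_of_fibres (ballType h) (measurableSet_ballType h) ?_
  intro a b
  induction a using Quotient.inductionOn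
  induction b using Quotient.inductionOn
  exact fun e => hs _ _ (ballType_mk_eq_iff.1 e)

/-- Sets of finite families of trees described in terms of the first `h` levels are measurable. -/
theorem measurableSet_pi_of_ballType {ι : Type} [Finite ι] (h : ℕ) {s : Set (ι → Tn n)}
    (hs : ∀ x y : ι → Tn n, (∀ i, ballType h (x i) = ballType h (y i)) → x ∈ s → y ∈ s) :
    MeasurableSet s := by
  refine measurableSet_of_fibres (fun x i => ballType h (x i)) (fun q => ?_)
    fun a b hab => hs a b fun i => congrFun hab i
  have : {x : ι → Tn n | (fun i => ballType h (x i)) = q} =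
      ⋂ i, (fun x : ι → Tn n => x i) ⁻¹' {t | ballType h t = q i} := by
    ext x
    simp [funext_iff]
  rw [this]
  exact MeasurableSet.iInter fun i => measurable_pi_apply i (measurableSet_ballType h (q i))

/-! ### Grafts of isomorphism classes -/

/-- The family obtained from `x` by adding the tree `t`. -/
def cons {ι : Type} (t : Tn n) (x : ι → Tn n) : Option ι → Tn n := fun o => o.elim t x

theorem measurable_cons {ι : Type} :
    Measurable fun z : (ι → Tn n) × Tn n => cons z.2 z.1 := by
  refine measurable_pi_iff.2 fun o => ?_
  cases o with
  | none => exact measurable_snd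
  | some s => exact (measurable_pi_apply s).comp measurable_fst

section graft

variable {ι κ : Type} [Finite ι] [Finite κ]

/-- The graft of the trees `x`, rerooted at the root of the piece `x s`. -/
noncomputable def rerootGraft (i : Fin n) (x : ι → Tn n) (s : ι) : Tn n :=
  ⟦(graftTree i fun s => (x s).out).reroot (some ⟨s, (x s).out.root⟩)⟧

theorem out_mk_equiv (S : LTree n) : LTree.Equiv (⟦S⟧ : Tn n).out S :=
  Quotient.exact (s := LTree.instSetoid) (Quotient.out_eq _)

theorem graft_mk (i : Fin n) (X : ι → LTree n) :
    graft i (fun s => (⟦X s⟧ : Tn n)) = ⟦graftTree i X⟧ := by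
  obtain ⟨φ, h, hl, -⟩ := exists_graftTree_iso i (_root_.Equiv.refl ι)
    fun s => out_mk_equiv (X s)
  exact Quotient.sound ⟨φ, h, hl⟩

theorem rerootGraft_mk (i : Fin n) (X : ι → LTree n) (s : ι) :
    rerootGraft i (fun s => (⟦X s⟧ : Tn n)) s =
      ⟦(graftTree i X).reroot (some ⟨s, (X s).root⟩)⟧ := by
  obtain ⟨φ, -, hl, h⟩ := exists_graftTree_iso i (_root_.Equiv.refl ι)
    fun s => out_mk_equiv (X s)
  exact Quotient.sound ⟨φ, h s, hl⟩

theorem graft_comp (i : Fin n) (e : ι ≃ κ) (x : κ → Tn n) : graft i (x ∘ e) = graft i x := by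
  obtain ⟨φ, h, hl, -⟩ := exists_graftTree_iso i (x := fun s => (x (e s)).out)
    (y := fun s => (x s).out) e fun s => LTree.equiv_equivalence.refl _
  exact Quotient.sound ⟨φ, h, hl⟩

theorem rerootGraft_comp (i : Fin n) (e : ι ≃ κ) (x : κ → Tn n) (s : ι) :
    rerootGraft i (x ∘ e) s = rerootGraft i x (e s) := by
  obtain ⟨φ, -, hl, h⟩ := exists_graftTree_iso i (x := fun s => (x (e s)).out)
    (y := fun s => (x s).out) e fun s => LTree.equiv_equivalence.refl _
  exact Quotient.sound ⟨φ, h s, hl⟩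

/-- Two grafts joined by an edge, rooted at either end of that edge. -/
theorem rerootGraft_cons (i j : Fin n) (x : ι → Tn n) (y : κ → Tn n) :
    rerootGraft i (cons (graft j y) x) none = graft j (cons (graft i x) y) := by
  have hx : cons (graft j y) x = fun o => (⟦(o.elim (graftTree j fun s => (y s).out)
      fun s => (x s).out : LTree n)⟧ : Tn n) := by
    funext o
    cases o with
    | none => rfl
    | some s => exact (Quotient.out_eq _).symm
  have hy : cons (graft i x) y = fun o => (⟦(o.elim (graftTree i fun s => (x s).out)
      fun s => (y s).out : LTree n)⟧ : Tn n) := by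
    funext o
    cases o with
    | none => rfl
    | some s => exact (Quotient.out_eq _).symm
  rw [hx, hy, rerootGraft_mk, graft_mk]
  exact Quotient.sound (graftTree_double i j (fun s => (x s).out) fun s => (y s).out)

theorem measurable_graft (i : Fin n) : Measurable (graft (ι := ι) i) := by
  refine measurable_of_ballType fun h q => measurableSet_pi_of_ballType h ?_
  intro x y hxy hx
  rw [mem_ofPred_eq] at hx ⊢
  rw [← hx]
  refine (ballType_mk_eq_iff.2 ?_).symm
  exact (graftTree_ballEquiv i fun s => ballType_eq_iff_out.1 (hxy s)).mono (Nat.le_succ h)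

theorem measurable_rerootGraft (i : Fin n) (s : ι) :
    Measurable fun x : ι → Tn n => rerootGraft i x s := by
  refine measurable_of_ballType fun h q => measurableSet_pi_of_ballType h ?_
  intro x y hxy hx
  rw [mem_ofPred_eq] at hx ⊢
  rw [← hx]
  refine (ballType_mk_eq_iff.2 ?_).symm
  exact graftTree_reroot_ballEquiv i (fun s => ballType_eq_iff_out.1 (hxy s)) s

@[simp] theorem rootLabel_graft (i : Fin n) (x : ι → Tn n) : rootLabel (graft i x) = i := rfl

theorem rootLabel_eq_out (t : Tn n) : rootLabel t = t.out.label t.out.root := by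
  conv_lhs => rw [← Quotient.out_eq t]
  rfl

theorem ncard_graftTree_nbrs (i : Fin n) (X : ι → LTree n) (P : (graftTree i X).V → Prop) :
    {v | (graftTree i X).G.Adj (graftTree i X).root v ∧ P v}.ncard =
      {s | P (some ⟨s, (X s).root⟩)}.ncard := by
  have hinj : Function.Injective
      fun s => (some ⟨s, (X s).root⟩ : Option (Σ s, (X s).V)) := by
    intro s t h
    exact congrArg Sigma.fst (Option.some.inj h)
  rw [← Set.ncard_image_of_injective _ hinj]
  congr 1
  ext v
  constructor
  · rintro ⟨h, hP⟩
    rcases v with _ | ⟨s, a⟩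
    · exact h.elim
    · have : a = (X s).root := h
      subst this
      exact ⟨s, hP, rfl⟩
  · rintro ⟨s, hs, rfl⟩
    exact ⟨rfl, hs⟩

theorem nbrCount_graft (i : Fin n) (x : ι → Tn n) (j : Fin n) :
    nbrCount (graft i x) j = {s | rootLabel (x s) = j}.ncard := by
  simp only [rootLabel_eq_out]
  exact ncard_graftTree_nbrs i (fun s => (x s).out)
    fun v => (graftTree i fun s => (x s).out).label v = j

theorem stepCount_graft (i : Fin n) (x : ι → Tn n) (B : Set (Tn n)) :
    stepCount (graft i x) B = {s | rerootGraft i x s ∈ B}.ncard :=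
  ncard_graftTree_nbrs i (fun s => (x s).out)
    fun v => (⟦(graftTree i fun s => (x s).out).reroot v⟧ : Tn n) ∈ B

end graft

/-! ### Measurability of the maps on trees -/

theorem LTree.BallMaps.ncard_le {h : ℕ} {S T : LTree n} {f : S.V → T.V} {g : T.V → S.V}
    (H : LTree.BallMaps (h + 1) S T f g) {P : S.V → Prop} {Q : T.V → Prop}
    (hPQ : ∀ v, S.G.Adj S.root v → P v → Q (f v)) :
    {v | S.G.Adj S.root v ∧ P v}.ncard ≤ {v | T.G.Adj T.root v ∧ Q v}.ncard := by
  have hball : ∀ v, S.G.Adj S.root v → v ∈ S.ball (h + 1) :=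
    fun v hv => S.ball_mono (by omega) (S.mem_ball_one_of_adj hv)
  refine Set.ncard_le_ncard_of_injOn f ?_ ?_ ((T.finite_nbrs T.root).subset fun v hv => hv.1)
  · rintro v ⟨hv, hP⟩
    refine ⟨?_, hPQ v hv hP⟩
    rw [← H.left.root]
    exact H.left.adj _ (S.root_mem_ball _) _ (hball v hv) hv
  · rintro u ⟨hu, -⟩ v ⟨hv, -⟩ huv
    rw [← H.left_inv u (hball u hu), ← H.left_inv v (hball v hv), huv]

theorem measurable_rootLabel : Measurable (rootLabel : Tn n → Fin n) := by
  refine fun s _ => measurableSet_of_ballType 0 fun S T e hS => ?_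
  obtain ⟨f, g, H⟩ := LTree.ballEquiv_iff.1 e
  have : rootLabel (⟦T⟧ : Tn n) = rootLabel ⟦S⟧ := by
    change T.label T.root = S.label S.root
    rw [← H.left.root, H.left.label _ (S.root_mem_ball 0)]
  rwa [mem_preimage, this]

theorem measurable_nbrCount : Measurable (nbrCount : Tn n → Fin n → ℕ) := by
  have key : ∀ S T : LTree n, LTree.BallEquiv 1 S T → ∀ j, S.nbrCount j ≤ T.nbrCount j := by
    intro S T e j
    obtain ⟨f, g, H⟩ := LTree.ballEquiv_iff.1 e
    refine H.ncard_le fun v hv hj => ?_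
    rw [H.left.label v (S.mem_ball_one_of_adj hv), hj]
  refine fun s _ => measurableSet_of_ballType 1 fun S T e hS => ?_
  have : nbrCount (⟦T⟧ : Tn n) = nbrCount ⟦S⟧ :=
    funext fun j => le_antisymm (key T S e.symm j) (key S T e j)
  rwa [mem_preimage, this]

theorem measurableSet_N (i : Fin n) : MeasurableSet (N i) :=
  measurable_rootLabel (measurableSet_singleton i)

theorem measurableSet_Nc (i : Fin n) (c : Fin n → ℕ) : MeasurableSet (Nc i c) :=
  (measurableSet_N i).inter (measurable_nbrCount (measurableSet_singleton c))

/-- The unnormalized law of a step of simple random walk. -/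
noncomputable def stepMeasure (T : LTree n) : Measure (Tn n) :=
  ∑ v ∈ (T.finite_nbrs T.root).toFinset, Measure.dirac (⟦T.reroot v⟧ : Tn n)

theorem stepMeasure_apply (T : LTree n) {B : Set (Tn n)} (hB : MeasurableSet B) :
    stepMeasure T B = stepCount ⟦T⟧ B := by
  classical
  have : stepCount (⟦T⟧ : Tn n) B =
      ((T.finite_nbrs T.root).toFinset.filter fun v => (⟦T.reroot v⟧ : Tn n) ∈ B).card := by
    rw [← Set.ncard_coe_finset]
    change Set.ncard _ = _
    congr 1
    ext v
    simp
  rw [this, stepMeasure, Measure.finsetSum_apply]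
  simp [Measure.dirac_apply' _ hB, Set.indicator_apply, Finset.sum_boole]

instance (T : LTree n) : IsFiniteMeasure (stepMeasure T) := by
  unfold stepMeasure
  infer_instance

/-- The number of neighbours at which the rerooted tree lies in `B` is determined by `h + 1` levels
when `B` is determined by `h` levels; a Dynkin system argument extends measurability to all `B`. -/
theorem measurable_stepCount {B : Set (Tn n)} (hB : MeasurableSet B) :
    Measurable fun t => (stepCount t B : ℝ≥0∞) := by
  have hrep : ∀ (t : Tn n) {B : Set (Tn n)}, MeasurableSet B →
      (stepCount t B : ℝ≥0∞) = stepMeasure t.out B := by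
    intro t B hB
    rw [stepMeasure_apply _ hB, Quotient.out_eq]
  have hball : ∀ (h : ℕ) (B : Set (Tn n)), (∀ s t, ballType h s = ballType h t → s ∈ B → t ∈ B) →
      Measurable fun t => (stepCount t B : ℝ≥0∞) := by
    intro h B hB s _
    have key : ∀ S T : LTree n, LTree.BallEquiv (h + 1) S T →
        stepCount (⟦S⟧ : Tn n) B ≤ stepCount (⟦T⟧ : Tn n) B := by
      intro S T e
      obtain ⟨f, g, H⟩ := LTree.ballEquiv_iff.1 e
      refine H.ncard_le fun v hv hS => hB _ _ ?_ hS
      exact ballType_mk_eq_iff.2 (LTree.ballEquiv_iff.2 ⟨f, g, H.reroot hv⟩)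
    refine measurableSet_of_ballType (h + 1) fun S T e hS => ?_
    rwa [mem_preimage, le_antisymm (key T S e.symm) (key S T e)]
  induction B, hB using MeasurableSpace.induction_on_inter (instMeasurableSpaceTn_eq n)
    (isPiSystem_generators n) with
  | empty => exact hball 0 ∅ fun _ _ _ h => h
  | basic B hB =>
    obtain ⟨h, q, rfl⟩ := hB
    exact hball h _ fun s t hst hs => hst.symm.trans hs
  | compl B hB ih =>
    have h1 := hball 0 univ fun _ _ _ h => h
    have : (fun t => (stepCount t Bᶜ : ℝ≥0∞)) =
        fun t => (stepCount t univ : ℝ≥0∞) - stepCount t B := by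
      funext t
      rw [hrep t hB.compl, hrep t .univ, hrep t hB, measure_compl hB (measure_ne_top _ _)]
    rw [this]
    exact h1.sub ih
  | iUnion f hd hf ih =>
    have : (fun t => (stepCount t (⋃ k, f k) : ℝ≥0∞)) =
        fun t => ∑' k, (stepCount t (f k) : ℝ≥0∞) := by
      funext t
      rw [hrep t (.iUnion hf), measure_iUnion hd hf]
      exact tsum_congr fun k => (hrep t (hf k)).symm
    rw [this]
    exact Measurable.tsum ih

theorem measurableSet_born (u : List (Fin n × ℕ)) :
    MeasurableSet {ω : List (Fin n × ℕ) → Fin n → ℕ | Born ω u} := by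
  induction u with
  | nil => exact MeasurableSet.univ
  | cons x u ih =>
    have : Measurable fun ω : List (Fin n × ℕ) → Fin n → ℕ => ω u x.1 :=
      (measurable_pi_apply x.1).comp (measurable_pi_apply u)
    exact ih.inter (measurableSet_lt (measurable_const (a := x.2)) this)

theorem mem_ball_length (i : Fin n) (ω : List (Fin n × ℕ) → Fin n → ℕ) :
    ∀ (u : List (Fin n × ℕ)) (hu : Born ω u),
      (⟨u, hu⟩ : {u // Born ω u}) ∈ (familyTree i ω).ball u.length
  | [], _ => LTree.root_mem_ball _ _
  | x :: u, hu => by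
    have h1 := mem_ball_length i ω u hu.1
    have h2 := (familyTree i ω).dist_le_succ_of_adj
      (a := (⟨u, hu.1⟩ : {u // Born ω u})) (b := (⟨x :: u, hu⟩ : {u // Born ω u}))
      (Or.inl ⟨x, rfl⟩)
    exact h2.trans (Nat.succ_le_succ h1)

theorem finite_born (ω : List (Fin n × ℕ) → Fin n → ℕ) (h : ℕ) :
    {u | Born ω u ∧ u.length ≤ h}.Finite := by
  rcases isEmpty_or_nonempty (Fin n) with hn | ⟨⟨i⟩⟩
  · exact (Set.finite_singleton []).subset fun u _ => by
      cases u with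
      | nil => rfl
      | cons x _ => exact (hn.false x.1).elim
  · refine (((familyTree i ω).ball_finite h).image Subtype.val).subset ?_
    rintro u ⟨hu, hl⟩
    exact ⟨⟨u, hu⟩, (familyTree i ω).ball_mono hl (mem_ball_length i ω u hu), rfl⟩

theorem measurable_familyTree (i : Fin n) : Measurable fun ω => (⟦familyTree i ω⟧ : Tn n) := by
  refine measurable_of_ballType fun h q => ?_
  refine measurableSet_of_fibres (fun ω => (finite_born ω h).toFinset) (fun s => ?_) ?_
  · have : {ω : List (Fin n × ℕ) → Fin n → ℕ | (finite_born ω h).toFinset = s} =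
        ⋂ u, {ω | (Born ω u ∧ u.length ≤ h) ↔ u ∈ s} := by
      ext ω
      simp [Finset.ext_iff]
    rw [this]
    refine MeasurableSet.iInter fun u => ?_
    exact MeasurableSet.iff ((measurableSet_born u).inter (.const _)) (.const _)
  · intro ω ω' H hω
    rw [mem_ofPred_eq] at hω ⊢
    rw [← hω]
    refine (ballType_mk_eq_iff.2 (familyTree_ballEquiv i fun u hu => ?_)).symm
    have := Finset.ext_iff.1 H u
    simpa [hu] using this

/-! ### The branching property -/

namespace GW

instance (ν : GW n) (i : Fin n) : IsProbabilityMeasure (ν.lawFrom i) :=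
  Measure.isProbabilityMeasure_map (measurable_familyTree i).aemeasurable

/-- The law of a family of independent Galton-Watson trees with roots of types `τ`. -/
noncomputable def pieces (ν : GW n) {ι : Type} [Fintype ι] (τ : ι → Fin n) : Measure (ι → Tn n) :=
  Measure.pi fun s => ν.lawFrom (τ s)

instance (ν : GW n) {ι : Type} [Fintype ι] (τ : ι → Fin n) : IsProbabilityMeasure (ν.pieces τ) :=
  inferInstanceAs (IsProbabilityMeasure (Measure.pi _))

/-- The index set of the neighbours of a root with `c j` neighbours of type `j`. -/
abbrev Idx (c : Fin n → ℕ) : Type := Σ j, Fin (c j)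

theorem graftLaw_eq (ν : GW n) (i : Fin n) (c : Fin n → ℕ) :
    ν.graftLaw i c = (ν.pieces (Sigma.fst : Idx c → Fin n)).map (graft i) := rfl

instance (ν : GW n) (i : Fin n) (c : Fin n → ℕ) : IsProbabilityMeasure (ν.graftLaw i c) :=
  Measure.isProbabilityMeasure_map (measurable_graft i).aemeasurable

/-- The offspring vector of the root is independent of the offspring vectors in the lines of
descent of its children, and the latter are distributed as in independent trees. -/
theorem infinitePi_children (ν : GW n) (i : Fin n) (c : Fin n → ℕ)
    {S : Set (Idx c → List (Fin n × ℕ) → Fin n → ℕ)} (hS : MeasurableSet S) :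
    (Measure.infinitePi fun u : List (Fin n × ℕ) => (ν.offspring (indType i u)).toMeasure)
      {ω | ω [] = c ∧ (fun (s : Idx c) u => ω (u ++ [(s.1, (s.2 : ℕ))])) ∈ S} =
    ν.offspring i c * (Measure.pi fun s : Idx c =>
      Measure.infinitePi fun u : List (Fin n × ℕ) => (ν.offspring (indType s.1 u)).toMeasure) S := by
  classical
  -- The individuals are grouped into the root alone and the lines of descent of its children.
  let κ : Option (Idx c) → Type := fun o => o.elim Unit fun _ => List (Fin n × ℕ)
  let f : (Σ o, κ o) → List (Fin n × ℕ) := fun a =>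
    match a with
    | ⟨none, _⟩ => []
    | ⟨some s, u⟩ => (show List (Fin n × ℕ) from u) ++ [(s.1, (s.2 : ℕ))]
  have hf : Function.Injective f := by
    rintro ⟨_ | ⟨j, m⟩, u⟩ ⟨_ | ⟨j', m'⟩, v⟩ h
    · rfl
    · exact absurd h.symm (List.append_ne_nil_of_right_ne_nil _ (List.cons_ne_nil _ _))
    · exact absurd h (List.append_ne_nil_of_right_ne_nil _ (List.cons_ne_nil _ _))
    · obtain ⟨h1, h2⟩ := List.append_inj' h rfl
      simp only [List.cons.injEq, Prod.mk.injEq, and_true] at h2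
      obtain ⟨rfl, h2⟩ := h2
      obtain rfl := Fin.ext h2
      dsimp only at h1
      rw [show u = v from h1]
  let Q : (Σ o, κ o) → Measure (Fin n → ℕ) := fun a => (ν.offspring (indType i (f a))).toMeasure
  have h1 := Measure.map_infinitePi_infinitePi_of_inj
    (P := fun u : List (Fin n × ℕ) => (ν.offspring (indType i u)).toMeasure) hf
  have h2 := Measure.infinitePi_map_piCurry (κ := κ) (X := fun _ _ => Fin n → ℕ)
    (fun o u => Q ⟨o, u⟩)
  rw [Measure.infinitePi_eq_pi (μ := fun o => Measure.infinitePi fun u : κ o => Q ⟨o, u⟩),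
    ← Measure.pi_map_piOptionEquivProd] at h2
  let E : Set (∀ o, κ o → Fin n → ℕ) := {z | z none () = c ∧ (fun s => z (some s)) ∈ S}
  have hE : MeasurableSet E := by
    refine MeasurableSet.inter ?_ ?_
    · have : Measurable fun z : (∀ o, κ o → Fin n → ℕ) => z none () :=
        (measurable_pi_apply _).comp (measurable_pi_apply _)
      exact this (measurableSet_singleton c)
    · have : Measurable fun (z : ∀ o, κ o → Fin n → ℕ) (s : Idx c) => z (some s) :=
        measurable_pi_iff.2 fun s => measurable_pi_apply _
      exact this hS
  have h3 := DFunLike.congr_fun h2 E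
  rw [Measure.map_apply (MeasurableEquiv.measurable _) hE] at h3
  erw [← h1] at h3
  rw [Measure.map_apply (by fun_prop) (MeasurableEquiv.measurable _ hE),
    Measure.map_apply (MeasurableEquiv.measurable _) hE] at h3
  refine (Eq.trans ?_ h3).trans ?_
  · rfl
  · have : (MeasurableEquiv.piOptionEquivProd fun o : Option (Idx c) => κ o → Fin n → ℕ).symm ⁻¹' E
        = S ×ˢ {g : Unit → Fin n → ℕ | g () = c} := by
      ext ⟨x, g⟩
      exact and_comm
    have hnone : (Measure.infinitePi fun u : κ none => Q ⟨none, u⟩) {g | g () = c} =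
        ν.offspring i c := by
      have := (measurePreserving_eval_infinitePi (fun u : κ none => Q ⟨none, u⟩)
        ()).measure_preimage (measurableSet_singleton c).nullMeasurableSet
      refine this.trans ?_
      exact PMF.toMeasure_apply_singleton _ _ (measurableSet_singleton c)
    rw [this]
    refine (Measure.prod_prod (μ := Measure.pi fun s : Idx c =>
      Measure.infinitePi fun u : κ (some s) => Q ⟨some s, u⟩)
      (ν := Measure.infinitePi fun u : κ none => Q ⟨none, u⟩) S {g | g () = c}).trans ?_
    refine (mul_comm _ _).trans (congrArg₂ (· * ·) hnone ?_)
    refine congrArg (fun m : Measure _ => m S) ?_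
    refine congrArg Measure.pi (funext fun s => ?_)
    refine congrArg Measure.infinitePi (funext fun u => ?_)
    exact congrArg (fun j => (ν.offspring j).toMeasure) (indType_append i u _)

theorem map_pieces_familyTree (ν : GW n) (i : Fin n) (c : Fin n → ℕ) :
    ν.graftLaw i c = (Measure.pi fun s : Idx c =>
      Measure.infinitePi fun u : List (Fin n × ℕ) => (ν.offspring (indType s.1 u)).toMeasure).map
        fun z => graft i fun s : Idx c => (⟦familyTree s.1 (z s)⟧ : Tn n) := by
  have h1 : ν.pieces (Sigma.fst : Idx c → Fin n) = (Measure.pi fun s : Idx c =>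
      Measure.infinitePi fun u : List (Fin n × ℕ) => (ν.offspring (indType s.1 u)).toMeasure).map
        fun z (s : Idx c) => (⟦familyTree s.1 (z s)⟧ : Tn n) := by
    have : ∀ s : Idx c, SigmaFinite ((Measure.infinitePi fun u : List (Fin n × ℕ) =>
        (ν.offspring (indType s.1 u)).toMeasure).map
          fun ω => (⟦familyTree s.1 ω⟧ : Tn n)) := fun s =>
      inferInstanceAs (SigmaFinite (ν.lawFrom s.1))
    exact (Measure.pi_map_pi (μ := fun s : Idx c => Measure.infinitePi
      fun u : List (Fin n × ℕ) => (ν.offspring (indType s.1 u)).toMeasure)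
      (f := fun s ω => (⟦familyTree s.1 ω⟧ : Tn n))
      fun s => (measurable_familyTree s.1).aemeasurable).symm
  rw [graftLaw_eq, h1, Measure.map_map (measurable_graft i)]
  · rfl
  · exact measurable_pi_iff.2 fun s => (measurable_familyTree s.1).comp (measurable_pi_apply s)

/-- The branching property: a Galton-Watson tree is the graft of independent Galton-Watson trees
at a root with random offspring. -/
theorem lawFrom_apply (ν : GW n) (i : Fin n) {A : Set (Tn n)} (hA : MeasurableSet A) :
    ν.lawFrom i A = ∑' c, ν.offspring i c * ν.graftLaw i c A := by
  have hm := measurable_familyTree i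
  have hroot : Measurable fun ω : List (Fin n × ℕ) → Fin n → ℕ => ω [] := measurable_pi_apply _
  rw [lawFrom, Measure.map_apply hm hA]
  have : (fun ω => (⟦familyTree i ω⟧ : Tn n)) ⁻¹' A =
      ⋃ c, {ω | ω [] = c ∧ (⟦familyTree i ω⟧ : Tn n) ∈ A} := by
    ext ω
    simp
  rw [this, measure_iUnion]
  · refine tsum_congr fun c => ?_
    have hg : Measurable fun (z : Idx c → List (Fin n × ℕ) → Fin n → ℕ) =>
        graft i fun s => (⟦familyTree s.1 (z s)⟧ : Tn n) :=
      (measurable_graft i).comp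
        (measurable_pi_iff.2 fun s => (measurable_familyTree s.1).comp (measurable_pi_apply s))
    rw [map_pieces_familyTree, Measure.map_apply hg hA, ← infinitePi_children ν i c (hg hA)]
    congr 1
    ext ω
    refine and_congr_right fun hc => ?_
    rw [mem_preimage,
      graft_mk i fun s : Idx c => familyTree s.1 fun u => ω (u ++ [(s.1, (s.2 : ℕ))])]
    have := Quotient.sound (s := LTree.instSetoid) (familyTree_equiv_graftTree i ω c hc)
    exact iff_of_eq (congrArg (· ∈ A) this.symm)
  · intro c c' hcc
    exact Set.disjoint_left.2 fun ω h h' => hcc (h.1.symm.trans h'.1)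
  · exact fun c => (hroot (measurableSet_singleton c)).inter (hm hA)

theorem ae_rootLabel_lawFrom (ν : GW n) (i : Fin n) : ∀ᵐ t ∂ν.lawFrom i, rootLabel t = i := by
  rw [lawFrom, ae_map_iff (measurable_familyTree i).aemeasurable (measurableSet_N i)]
  exact Filter.Eventually.of_forall fun ω => rfl

theorem ae_rootLabel_pieces (ν : GW n) {ι : Type} [Fintype ι] (τ : ι → Fin n) :
    ∀ᵐ x ∂ν.pieces τ, ∀ s, rootLabel (x s) = τ s :=
  Filter.eventually_all.2 fun s =>
    (Measure.tendsto_eval_ae_ae (μ := fun s => ν.lawFrom (τ s)) (i := s)).eventually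
      (ν.ae_rootLabel_lawFrom (τ s))

theorem ncard_idx (c : Fin n → ℕ) (j : Fin n) : {s : Idx c | s.1 = j}.ncard = c j := by
  have : {s : Idx c | s.1 = j} = range (Sigma.mk j) := by
    ext ⟨k, m⟩
    constructor
    · intro h
      dsimp at h
      subst h
      exact ⟨m, rfl⟩
    · rintro ⟨m', h⟩
      exact (congrArg Sigma.fst h).symm
  rw [this, ← Set.image_univ, Set.ncard_image_of_injective _ sigma_mk_injective]
  simp

theorem ae_mem_Nc_graftLaw (ν : GW n) (i : Fin n) (c : Fin n → ℕ) :
    ∀ᵐ t ∂ν.graftLaw i c, t ∈ Nc i c := by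
  rw [graftLaw_eq]
  refine (ae_map_iff (p := fun t => t ∈ Nc i c) (measurable_graft i).aemeasurable
    (measurableSet_Nc i c)).2 ?_
  filter_upwards [ν.ae_rootLabel_pieces (Sigma.fst : Idx c → Fin n)] with x hx
  refine ⟨rfl, funext fun j => ?_⟩
  rw [nbrCount_graft]
  simp only [hx]
  exact ncard_idx c j

theorem graftLaw_Nc_inter (ν : GW n) (i : Fin n) (c : Fin n → ℕ) (A : Set (Tn n)) :
    ν.graftLaw i c (Nc i c ∩ A) = ν.graftLaw i c A := by
  refine measure_congr ?_
  filter_upwards [ν.ae_mem_Nc_graftLaw i c] with t ht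
  exact propext ⟨fun h => h.2, fun h => ⟨ht, h⟩⟩

theorem graftLaw_Nc_self (ν : GW n) (i : Fin n) (c : Fin n → ℕ) : ν.graftLaw i c (Nc i c) = 1 := by
  have := ν.graftLaw_Nc_inter i c univ
  rwa [inter_univ, measure_univ] at this

theorem graftLaw_Nc_inter_of_ne (ν : GW n) {i j : Fin n} {c d : Fin n → ℕ}
    (h : ¬ (i = j ∧ c = d)) (A : Set (Tn n)) : ν.graftLaw i c (Nc j d ∩ A) = 0 := by
  refine measure_mono_null inter_subset_left ?_
  rw [measure_eq_zero_iff_ae_notMem]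
  filter_upwards [ν.ae_mem_Nc_graftLaw i c] with t ht ht'
  exact h ⟨ht.1.symm.trans ht'.1, ht.2.symm.trans ht'.2⟩

theorem lawFrom_Nc (ν : GW n) (i : Fin n) (c : Fin n → ℕ) :
    ν.lawFrom i (Nc i c) = ν.offspring i c := by
  rw [lawFrom_apply ν i (measurableSet_Nc i c), tsum_eq_single c, graftLaw_Nc_self, mul_one]
  intro c' hc'
  have := ν.graftLaw_Nc_inter_of_ne (i := i) (j := i) (c := c') (d := c) (fun h => hc' h.2) univ
  rw [inter_univ] at this
  rw [this, mul_zero]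

theorem map_nbrCount_lawFrom (ν : GW n) (i : Fin n) :
    (ν.lawFrom i).map nbrCount = (ν.offspring i).toMeasure := by
  refine Measure.ext_of_singleton fun c => ?_
  rw [Measure.map_apply measurable_nbrCount (measurableSet_singleton c),
    PMF.toMeasure_apply_singleton _ _ (measurableSet_singleton c), ← lawFrom_Nc]
  refine measure_congr ?_
  filter_upwards [ν.ae_rootLabel_lawFrom i] with t ht
  exact propext ⟨fun h => ⟨ht, h⟩, fun h => h.2⟩

theorem law_N_inter (ν : GW n) (i : Fin n) (A : Set (Tn n)) :
    ν.law (N i ∩ A) = ν.rootType i * ν.lawFrom i A := by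
  rw [law, Measure.finsetSum_apply, Finset.sum_eq_single i]
  · change ν.rootType i * _ = _
    congr 1
    refine measure_congr ?_
    filter_upwards [ν.ae_rootLabel_lawFrom i] with t ht
    exact propext ⟨fun h => h.2, fun h => ⟨ht, h⟩⟩
  · intro j _ hj
    change ν.rootType j * _ = 0
    rw [measure_mono_null inter_subset_left, mul_zero]
    rw [measure_eq_zero_iff_ae_notMem]
    filter_upwards [ν.ae_rootLabel_lawFrom j] with t ht ht'
    exact hj (ht.symm.trans ht')
  · intro h
    exact absurd (Finset.mem_univ i) h

theorem law_N (ν : GW n) (i : Fin n) : ν.law (N i) = ν.rootType i := by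
  have := ν.law_N_inter i univ
  rwa [inter_univ, measure_univ, mul_one] at this

theorem cond_law_N (ν : GW n) {i : Fin n} (hi : ν.rootType i ≠ 0) :
    ProbabilityTheory.cond ν.law (N i) = ν.lawFrom i := by
  ext A _
  rw [ProbabilityTheory.cond_apply (measurableSet_N i), law_N_inter ν i A, law_N, ← mul_assoc,
    ENNReal.inv_mul_cancel hi (ν.rootType.apply_ne_top i), one_mul]

theorem StronglyConnected.rootType_ne_zero {ν : GW n} (hν : ν.StronglyConnected) (i : Fin n) :
    ν.rootType i ≠ 0 := by
  rw [← law_N]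
  exact (hν i i).1.ne'

theorem StronglyConnected.nbrLaw_law {ν : GW n} (hν : ν.StronglyConnected) (i : Fin n) :
    nbrLaw ν.law i = (ν.offspring i).toMeasure := by
  rw [nbrLaw, cond_law_N ν (hν.rootType_ne_zero i), map_nbrCount_lawFrom]

/-- An individual of type `a` has a child of type `b` with positive probability. -/
def Step (ν : GW n) (a b : Fin n) : Prop := ∃ c, ν.offspring a c ≠ 0 ∧ 0 < c b

theorem measurableSet_hasLabel (j : Fin n) : MeasurableSet {t : Tn n | HasLabel j t} := by
  have : {t : Tn n | HasLabel j t} = ⋃ h : ℕ, {t | ∃ v ∈ t.out.ball h, t.out.label v = j} := by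
    ext t
    simp only [mem_iUnion, mem_ofPred_eq]
    conv_lhs => rw [← Quotient.out_eq t]
    exact ⟨fun ⟨v, hv⟩ => ⟨t.out.G.dist t.out.root v, v, le_refl (α := ℕ) _, hv⟩,
      fun ⟨_, v, _, hv⟩ => ⟨v, hv⟩⟩
  rw [this]
  refine MeasurableSet.iUnion fun h => measurableSet_of_ballType h ?_
  intro S T e hS
  have e' : LTree.BallEquiv h (⟦S⟧ : Tn n).out (⟦T⟧ : Tn n).out :=
    ballType_eq_iff_out.1 (ballType_mk_eq_iff.2 e)
  obtain ⟨f, g, H⟩ := LTree.ballEquiv_iff.1 e'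
  obtain ⟨v, hv, hj⟩ := hS
  exact ⟨f v, H.left.mem_ball le_rfl hv, (H.left.label v hv).trans hj⟩

/-- In a strongly connected Galton-Watson measure every type descends from every other type through
offspring vectors of positive probability. -/
theorem StronglyConnected.reachable {ν : GW n} (hν : ν.StronglyConnected) (i j : Fin n) :
    Relation.ReflTransGen ν.Step i j := by
  have h := (hν i j).2
  rw [cond_law_N ν (hν.rootType_ne_zero i), lawFrom,
    Measure.map_apply (measurable_familyTree i) (measurableSet_hasLabel j)] at h
  have hae : ∀ᵐ ω ∂(Measure.infinitePi fun u : List (Fin n × ℕ) =>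
      (ν.offspring (indType i u)).toMeasure), ∀ u, ν.offspring (indType i u) (ω u) ≠ 0 := by
    refine ae_all_iff.2 fun u => ?_
    have h1 : ∀ᵐ c ∂(ν.offspring (indType i u)).toMeasure, ν.offspring (indType i u) c ≠ 0 := by
      rw [ae_iff, PMF.toMeasure_apply_eq_zero_iff _ (Set.to_countable _).measurableSet,
        Set.disjoint_left]
      intro c hc hc'
      exact hc' hc
    exact (measurePreserving_eval_infinitePi (fun u : List (Fin n × ℕ) =>
      (ν.offspring (indType i u)).toMeasure) u).quasiMeasurePreserving.ae h1
  obtain ⟨ω, ⟨⟨u, hu⟩, hj⟩, hω⟩ :=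
    ((frequently_ae_mem_iff.2 h.ne').and_eventually hae).exists
  change indType i u = j at hj
  rw [← hj]
  clear hj
  induction u with
  | nil => exact Relation.ReflTransGen.refl
  | cons x u ih => exact (ih hu.1).tail ⟨_, hω u, lt_of_le_of_lt (Nat.zero_le _) hu.2⟩

end GW

/-! ### The flow of simple random walk between two sets of trees -/

namespace GW

theorem exists_eq_add_single {c : Fin n → ℕ} {j : Fin n} (hj : c j ≠ 0) :
    ∃ d : Fin n → ℕ, c = d + Pi.single j 1 := by
  refine ⟨c - Pi.single j 1, funext fun k => ?_⟩
  by_cases hk : k = j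
  · subst hk
    simp
    omega
  · simp [hk]

theorem sum_idx_ite (c : Fin n → ℕ) (k : Fin n) :
    ∑ j, ∑ _m : Fin (c j), (if j = k then 1 else 0) = c k := by
  simp only [Finset.sum_const, Finset.card_univ, Fintype.card_fin, smul_eq_mul, mul_ite, mul_one,
    mul_zero, Finset.sum_ite_eq', Finset.mem_univ, if_true]

/-- Marking a neighbour of type `j` of the root amounts to singling out one element of the index
set; the other ones are counted by `d`. -/
theorem exists_idx_equiv (d : Fin n → ℕ) (j : Fin n) (s : Idx (d + Pi.single j 1))
    (hs : s.1 = j) : ∃ e : Option (Idx d) ≃ Idx (d + Pi.single j 1), e none = s ∧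
      ∀ a, (e a).1 = a.elim j Sigma.fst := by
  classical
  let τ : Option (Idx d) → Fin n := fun a => a.elim j Sigma.fst
  have hcard : ∀ k, Nonempty ({a // τ a = k} ≃ {b : Idx (d + Pi.single j 1) // b.1 = k}) := by
    intro k
    refine ⟨Fintype.equivOfCardEq ?_⟩
    rw [Fintype.card_subtype, Fintype.card_subtype, Finset.card_filter, Finset.card_filter,
      Fintype.sum_option, Fintype.sum_sigma, Fintype.sum_sigma]
    refine Eq.trans ?_ (sum_idx_ite _ k).symm
    refine (congrArg (_ + ·) (sum_idx_ite d k)).trans ?_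
    by_cases hjk : j = k
    · subst hjk
      simp [τ, add_comm]
    · simp [τ, hjk, Ne.symm hjk]
  let e₀ : Option (Idx d) ≃ Idx (d + Pi.single j 1) :=
    (_root_.Equiv.sigmaFiberEquiv τ).symm.trans
      ((_root_.Equiv.sigmaCongrRight fun k => (hcard k).some).trans
        (_root_.Equiv.sigmaFiberEquiv (Sigma.fst : Idx (d + Pi.single j 1) → Fin n)))
  have he₀ : ∀ a, (e₀ a).1 = τ a := fun a => ((hcard (τ a)).some ⟨a, rfl⟩).2
  refine ⟨e₀.trans (_root_.Equiv.swap (e₀ none) s), by simp, fun a => ?_⟩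
  have hnone : (e₀ none).1 = j := he₀ none
  change (_root_.Equiv.swap (e₀ none) s (e₀ a)).1 = τ a
  rw [_root_.Equiv.swap_apply_def]
  split_ifs with h1 h2
  · rw [← he₀, h1, hnone, hs]
  · rw [← he₀, h2, hnone, hs]
  · exact he₀ a

theorem pieces_reindex (ν : GW n) {ι κ : Type} [Fintype ι] [Fintype κ] (e : ι ≃ κ)
    (τ : κ → Fin n) : MeasurePreserving (fun x : κ → Tn n => x ∘ e) (ν.pieces τ)
      (ν.pieces (τ ∘ e)) := by
  refine ⟨measurable_pi_iff.2 fun s => measurable_pi_apply _, ?_⟩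
  rw [pieces, ← Measure.infinitePi_eq_pi, pieces, ← Measure.infinitePi_eq_pi]
  exact Measure.map_infinitePi_infinitePi_of_inj (P := fun s => ν.lawFrom (τ s)) e.injective

theorem map_cons_pieces (ν : GW n) {ι : Type} [Fintype ι] (τ : ι → Fin n) (j : Fin n) :
    ((ν.pieces τ).prod (ν.lawFrom j)).map (fun z => cons z.2 z.1) =
      ν.pieces fun o : Option ι => o.elim j τ := by
  rw [pieces, pieces, ← Measure.pi_map_piOptionEquivProd]
  refine congrArg₂ Measure.map ?_ rfl
  funext z o
  cases o <;> rfl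

/-- The probability, for two independent grafts of Galton-Watson trees with roots of types `i` and
`j` and `c` and `d` children that are joined by an edge, that the joined tree belongs to `A` when
rooted at the first one, and to `B` when rooted at the second one. -/
noncomputable def joinProb (ν : GW n) (i j : Fin n) (c d : Fin n → ℕ) (A B : Set (Tn n)) : ℝ≥0∞ :=
  ((ν.pieces (Sigma.fst : Idx c → Fin n)).prod (ν.pieces (Sigma.fst : Idx d → Fin n)))
    {z | graft i (cons (graft j z.2) z.1) ∈ A ∧ graft j (cons (graft i z.1) z.2) ∈ B}

theorem measurable_join {ι κ : Type} [Finite ι] [Finite κ] (i j : Fin n) :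
    Measurable fun z : (ι → Tn n) × (κ → Tn n) => graft i (cons (graft j z.2) z.1) :=
  (measurable_graft i).comp (measurable_cons.comp
    (measurable_fst.prodMk ((measurable_graft j).comp measurable_snd)))

theorem joinProb_swap (ν : GW n) (i j : Fin n) (c d : Fin n → ℕ) {A B : Set (Tn n)}
    (hA : MeasurableSet A) (hB : MeasurableSet B) :
    ν.joinProb i j c d A B = ν.joinProb j i d c B A := by
  have hm : MeasurableSet {z : (Idx c → Tn n) × (Idx d → Tn n) |
      graft i (cons (graft j z.2) z.1) ∈ A ∧ graft j (cons (graft i z.1) z.2) ∈ B} :=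
    (measurable_join i j hA).inter (((measurable_join j i).comp measurable_swap) hB)
  rw [joinProb, ← Measure.prod_swap, Measure.map_apply measurable_swap hm, joinProb]
  congr 1
  ext z
  exact and_comm

/-- Marking a neighbour of the root of a graft: the marked piece is itself a graft. -/
theorem pieces_marked (ν : GW n) (i j : Fin n) (d : Fin n → ℕ) (s : Idx (d + Pi.single j 1))
    (hs : s.1 = j) {A B : Set (Tn n)} (hA : MeasurableSet A) (hB : MeasurableSet B) :
    ν.pieces (Sigma.fst : Idx (d + Pi.single j 1) → Fin n)
      {x | graft i x ∈ A ∧ rerootGraft i x s ∈ B} =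
    ∑' c, ν.offspring j c * ν.joinProb i j d c A B := by
  obtain ⟨e, hes, he⟩ := exists_idx_equiv d j s hs
  have hm : ∀ {ι : Type} [Finite ι] (s : ι),
      MeasurableSet {x : ι → Tn n | graft i x ∈ A ∧ rerootGraft i x s ∈ B} := fun s =>
    (measurable_graft i hA).inter (measurable_rerootGraft i s hB)
  have h1 : {x : Idx (d + Pi.single j 1) → Tn n | graft i x ∈ A ∧ rerootGraft i x s ∈ B} =
      (fun x : Idx (d + Pi.single j 1) → Tn n => x ∘ e) ⁻¹'
        {x | graft i x ∈ A ∧ rerootGraft i x none ∈ B} := by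
    ext x
    simp only [mem_ofPred_eq, mem_preimage, graft_comp, rerootGraft_comp, hes]
  have hτ : (Sigma.fst : Idx (d + Pi.single j 1) → Fin n) ∘ e =
      fun o : Option (Idx d) => o.elim j Sigma.fst := funext he
  have hm' := measurable_cons (n := n) (ι := Idx d) (hm none)
  rw [h1, (ν.pieces_reindex e _).measure_preimage (hm none).nullMeasurableSet, hτ,
    ← map_cons_pieces, Measure.map_apply measurable_cons (hm none),
    Measure.prod_apply hm']
  have hslice : ∀ x : Idx d → Tn n, MeasurableSet (Prod.mk x ⁻¹'
      ((fun z : (Idx d → Tn n) × Tn n => cons z.2 z.1) ⁻¹'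
        {x | graft i x ∈ A ∧ rerootGraft i x none ∈ B})) := fun x =>
    measurable_prodMk_left hm'
  have hjoin : ∀ c : Fin n → ℕ, MeasurableSet {z : (Idx d → Tn n) × (Idx c → Tn n) |
      graft i (cons (graft j z.2) z.1) ∈ A ∧ graft j (cons (graft i z.1) z.2) ∈ B} := fun c =>
    (measurable_join i j hA).inter (((measurable_join j i).comp measurable_swap) hB)
  have hgraft : ∀ (x : Idx d → Tn n) (c : Fin n → ℕ), ν.graftLaw j c (Prod.mk x ⁻¹'
      ((fun z : (Idx d → Tn n) × Tn n => cons z.2 z.1) ⁻¹'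
        {x | graft i x ∈ A ∧ rerootGraft i x none ∈ B})) =
      ν.pieces (Sigma.fst : Idx c → Fin n) (Prod.mk x ⁻¹' {z : (Idx d → Tn n) × (Idx c → Tn n) |
        graft i (cons (graft j z.2) z.1) ∈ A ∧ graft j (cons (graft i z.1) z.2) ∈ B}) := by
    intro x c
    rw [graftLaw_eq, Measure.map_apply (measurable_graft j) (hslice x)]
    congr 1
    ext y
    simp only [mem_preimage, mem_ofPred_eq, rerootGraft_cons]
  simp_rw [fun x => lawFrom_apply ν j (hslice x), hgraft]
  rw [lintegral_tsum fun c =>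
    ((measurable_measure_prodMk_left (hjoin c)).const_mul _).aemeasurable]
  refine tsum_congr fun c => ?_
  rw [lintegral_const_mul _ (measurable_measure_prodMk_left (hjoin c)), joinProb,
    Measure.prod_apply (hjoin c)]

/-- Substitution of `c = d + e_j`; the vectors with `c j = 0` do not contribute. -/
theorem tsum_mul_eq_tsum_add_single (j : Fin n) (F : (Fin n → ℕ) → ℝ≥0∞) :
    ∑' c : Fin n → ℕ, (c j : ℝ≥0∞) * F c =
      ∑' d : Fin n → ℕ, ((d j : ℝ≥0∞) + 1) * F (d + Pi.single j 1) := by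
  have hinj : Function.Injective fun d : Fin n → ℕ => d + Pi.single j 1 :=
    fun _ _ h => add_right_cancel h
  rw [← hinj.tsum_eq (f := fun c : Fin n → ℕ => (c j : ℝ≥0∞) * F c)]
  · simp
  · intro c hc
    have hc' : c j ≠ 0 := by
      rintro h
      exact hc (by simp [h])
    obtain ⟨d, rfl⟩ := exists_eq_add_single hc'
    exact ⟨d, rfl⟩

theorem lintegral_stepProb_graftLaw (ν : GW n) (i : Fin n) (c : Fin n → ℕ) {A B : Set (Tn n)}
    (hA : MeasurableSet A) (hB : MeasurableSet B) :
    ∫⁻ t in A, stepProb t B ∂ν.graftLaw i c =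
      (∑ s : Idx c, ν.pieces (Sigma.fst : Idx c → Fin n)
        {x | graft i x ∈ A ∧ rerootGraft i x s ∈ B}) / ((∑ j, c j : ℕ) : ℝ≥0∞) := by
  classical
  have hm : ∀ s : Idx c, MeasurableSet {x : Idx c → Tn n | graft i x ∈ A ∧ rerootGraft i x s ∈ B} :=
    fun s => (measurable_graft i hA).inter (measurable_rerootGraft i s hB)
  have h1 : ∫⁻ t in A, stepProb t B ∂ν.graftLaw i c =
      ∫⁻ t in A, (stepCount t B : ℝ≥0∞) * ((∑ j, c j : ℕ) : ℝ≥0∞)⁻¹ ∂ν.graftLaw i c := by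
    refine lintegral_congr_ae (ae_restrict_of_ae ?_)
    filter_upwards [ν.ae_mem_Nc_graftLaw i c] with t ht
    rw [stepProb, degree, ht.2, div_eq_mul_inv]
  rw [h1, lintegral_mul_const _ (measurable_stepCount hB), div_eq_mul_inv]
  congr 1
  rw [← lintegral_indicator hA, graftLaw_eq,
    lintegral_map ((measurable_stepCount hB).indicator hA) (measurable_graft i)]
  have h2 : ∀ x : Idx c → Tn n, A.indicator (fun t => (stepCount t B : ℝ≥0∞)) (graft i x) =
      ∑ s : Idx c, {x | graft i x ∈ A ∧ rerootGraft i x s ∈ B}.indicator 1 x := by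
    intro x
    by_cases hx : graft i x ∈ A
    · rw [indicator_of_mem hx, stepCount_graft, Set.ncard_eq_toFinset_card']
      simp [indicator_apply, hx, Finset.sum_boole]
    · simp [hx]
  simp_rw [h2]
  rw [lintegral_finsetSum _ fun s _ => measurable_one.indicator (hm s)]
  exact Finset.sum_congr rfl fun s _ => lintegral_indicator_one (hm s)

/-- The probability that the root has type `i` and neighbours `d + e_j`, and that the walk steps to
a neighbour of type `j`. -/
noncomputable def edgeMass (μ : Measure (Tn n)) (i j : Fin n) (d : Fin n → ℕ) : ℝ≥0∞ :=
  ((d j : ℝ≥0∞) + 1) * (μ (Nc i (d + Pi.single j 1)) /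
    ((∑ k, (d + Pi.single j 1 : Fin n → ℕ) k : ℕ) : ℝ≥0∞))

theorem iUnion_Nc : (⋃ p : Fin n × (Fin n → ℕ), Nc p.1 p.2) = univ :=
  eq_univ_of_forall fun t => mem_iUnion.2 ⟨(rootLabel t, nbrCount t), rfl, rfl⟩

theorem pairwise_disjoint_Nc :
    Pairwise (Function.onFun Disjoint fun p : Fin n × (Fin n → ℕ) => Nc p.1 p.2) := by
  intro p q hpq
  refine Set.disjoint_left.2 fun t hp hq => hpq ?_
  exact Prod.ext (hp.1.symm.trans hq.1) (hp.2.symm.trans hq.2)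

theorem Describes.eq_sum {ν : GW n} {μ : Measure (Tn n)} [IsFiniteMeasure μ]
    (h : ν.Describes μ) :
    μ = Measure.sum fun p : Fin n × (Fin n → ℕ) => μ (Nc p.1 p.2) • ν.graftLaw p.1 p.2 := by
  ext A hA
  rw [Measure.sum_apply _ hA]
  conv_lhs => rw [← univ_inter A, ← iUnion_Nc, iUnion_inter]
  rw [measure_iUnion (fun p q hpq => (pairwise_disjoint_Nc hpq).mono inter_subset_left
    inter_subset_left) fun p => (measurableSet_Nc _ _).inter hA]
  refine tsum_congr fun p => ?_
  change _ = μ (Nc p.1 p.2) * ν.graftLaw p.1 p.2 A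
  by_cases hp : μ (Nc p.1 p.2) = 0
  · rw [hp, zero_mul, measure_mono_null inter_subset_left hp]
  · rw [← h p.1 p.2 hp, ProbabilityTheory.cond_apply (measurableSet_Nc _ _), ← mul_assoc,
      ENNReal.mul_inv_cancel hp (measure_ne_top _ _), one_mul]

/-- The flow of the walk from `A` to `B` when the law of the tree is described by `ν`: the two
ends of an edge carry independent Galton-Watson trees. -/
theorem Describes.flow {ν : GW n} {μ : Measure (Tn n)} [IsFiniteMeasure μ] (h : ν.Describes μ)
    {A B : Set (Tn n)} (hA : MeasurableSet A) (hB : MeasurableSet B) :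
    ∫⁻ t in A, stepProb t B ∂μ = ∑ i, ∑ j, ∑' d, ∑' c,
      edgeMass μ i j d * ν.offspring j c * ν.joinProb i j d c A B := by
  have h1 : ∫⁻ t in A, stepProb t B ∂μ = ∑' p : Fin n × (Fin n → ℕ),
      μ (Nc p.1 p.2) * ∫⁻ t in A, stepProb t B ∂ν.graftLaw p.1 p.2 := by
    conv_lhs => rw [h.eq_sum]
    rw [Measure.restrict_sum _ hA, lintegral_sum_measure]
    refine tsum_congr fun p => ?_
    rw [Measure.restrict_smul, lintegral_smul_measure, smul_eq_mul]
  rw [h1, ENNReal.tsum_prod (f := fun i c => μ (Nc i c) * ∫⁻ t in A, stepProb t B ∂ν.graftLaw i c),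
    tsum_fintype]
  refine Finset.sum_congr rfl fun i _ => ?_
  let H : Fin n → (Fin n → ℕ) → ℝ≥0∞ := fun j d => ∑' c, ν.offspring j c * ν.joinProb i j d c A B
  have h2 : ∀ c : Fin n → ℕ, ∑ s : Idx c, ν.pieces (Sigma.fst : Idx c → Fin n)
      {x | graft i x ∈ A ∧ rerootGraft i x s ∈ B} =
      ∑ j, (c j : ℝ≥0∞) * H j (c - Pi.single j 1) := by
    intro c
    rw [Fintype.sum_sigma]
    refine Finset.sum_congr rfl fun j _ => ?_
    rw [Finset.sum_congr rfl (g := fun _ => H j (c - Pi.single j 1)), Finset.sum_const,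
      Finset.card_univ, Fintype.card_fin, nsmul_eq_mul]
    intro m _
    obtain ⟨d, rfl⟩ := exists_eq_add_single m.pos.ne'
    rw [add_tsub_cancel_right]
    exact ν.pieces_marked i j d ⟨j, m⟩ rfl hA hB
  have h3 : ∀ c : Fin n → ℕ, μ (Nc i c) * ∫⁻ t in A, stepProb t B ∂ν.graftLaw i c =
      ∑ j, (c j : ℝ≥0∞) * (μ (Nc i c) / ((∑ k, c k : ℕ) : ℝ≥0∞) * H j (c - Pi.single j 1)) := by
    intro c
    rw [lintegral_stepProb_graftLaw ν i c hA hB, h2, div_eq_mul_inv, Finset.sum_mul,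
      Finset.mul_sum]
    refine Finset.sum_congr rfl fun j _ => ?_
    rw [div_eq_mul_inv]
    ring
  simp_rw [h3]
  rw [Summable.tsum_finsetSum fun _ _ => ENNReal.summable]
  refine Finset.sum_congr rfl fun j _ => ?_
  refine (tsum_mul_eq_tsum_add_single j fun c =>
    μ (Nc i c) / ((∑ k, c k : ℕ) : ℝ≥0∞) * H j (c - Pi.single j 1)).trans ?_
  refine tsum_congr fun d => ?_
  rw [add_tsub_cancel_right, ← mul_assoc, ← edgeMass, ← ENNReal.tsum_mul_left]
  exact tsum_congr fun c => (mul_assoc _ _ _).symm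

theorem sum_add_single (d : Fin n → ℕ) (j : Fin n) :
    ∑ k, (d + Pi.single j 1 : Fin n → ℕ) k = ∑ k, d k + 1 := by
  simp [Finset.sum_add_distrib]

theorem nbrCount_graft_cons (i j : Fin n) (d : Fin n → ℕ) {x : Idx d → Tn n} {t : Tn n}
    (hx : ∀ s, rootLabel (x s) = s.1) (ht : rootLabel t = j) :
    nbrCount (graft i (cons t x)) = d + Pi.single j 1 := by
  classical
  funext k
  rw [nbrCount_graft, Set.ncard_eq_toFinset_card', Set.toFinset_ofPred, Finset.card_filter,
    Fintype.sum_option, Fintype.sum_sigma]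
  by_cases hjk : j = k
  · subst hjk
    simp [cons, hx, ht, add_comm]
  · simp [cons, hx, ht, hjk, Ne.symm hjk]

/-- In two grafts joined by an edge, the neighbours of each graft vertex are known, so the
probability that they take given values is `0` or `1`. -/
theorem joinProb_Nc (ν : GW n) (i j : Fin n) (d c : Fin n → ℕ) (i' j' : Fin n)
    (d' c' : Fin n → ℕ) :
    ν.joinProb i' j' d' c' (Nc i (d + Pi.single j 1)) (Nc j (c + Pi.single i 1)) =
      if i' = i ∧ j' = j ∧ d' = d ∧ c' = c then 1 else 0 := by
  have h1 := (Measure.quasiMeasurePreserving_fst (μ := ν.pieces (Sigma.fst : Idx d' → Fin n))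
    (ν := ν.pieces (Sigma.fst : Idx c' → Fin n))).ae (ν.ae_rootLabel_pieces _)
  have h2 := (Measure.quasiMeasurePreserving_snd (μ := ν.pieces (Sigma.fst : Idx d' → Fin n))
    (ν := ν.pieces (Sigma.fst : Idx c' → Fin n))).ae (ν.ae_rootLabel_pieces _)
  rw [joinProb]
  split_ifs with h
  · obtain ⟨rfl, rfl, rfl, rfl⟩ := h
    rw [← measure_univ (μ := (ν.pieces (Sigma.fst : Idx d' → Fin n)).prod
      (ν.pieces (Sigma.fst : Idx c' → Fin n)))]
    refine measure_congr ?_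
    filter_upwards [h1, h2] with z hz1 hz2
    refine propext ⟨fun _ => trivial, fun _ => ⟨⟨rfl, ?_⟩, rfl, ?_⟩⟩
    · exact nbrCount_graft_cons i' j' d' hz1 (rootLabel_graft j' z.2)
    · exact nbrCount_graft_cons j' i' c' hz2 (rootLabel_graft i' z.1)
  · rw [measure_eq_zero_iff_ae_notMem]
    filter_upwards [h1, h2] with z hz1 hz2 hz
    apply h
    have e1 : i' = i := hz.1.1
    have e2 : j' = j := hz.2.1
    have e3 := (nbrCount_graft_cons i' j' d' hz1 (rootLabel_graft j' z.2)).symm.trans hz.1.2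
    have e4 := (nbrCount_graft_cons j' i' c' hz2 (rootLabel_graft i' z.1)).symm.trans hz.2.2
    subst e1 e2
    exact ⟨rfl, rfl, add_right_cancel e3, add_right_cancel e4⟩

/-- The flow between the sets `Nc i (d + e_j)` and `Nc j (c + e_i)` has a single term. -/
theorem Describes.edgeMass_mul {ν : GW n} {μ : Measure (Tn n)} [IsFiniteMeasure μ]
    (h : ν.Describes μ) (i j : Fin n) (d c : Fin n → ℕ) :
    ∫⁻ t in Nc i (d + Pi.single j 1), stepProb t (Nc j (c + Pi.single i 1)) ∂μ =
      edgeMass μ i j d * ν.offspring j c := by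
  rw [h.flow (measurableSet_Nc _ _) (measurableSet_Nc _ _)]
  simp_rw [joinProb_Nc]
  rw [Finset.sum_eq_single i, Finset.sum_eq_single j, tsum_eq_single d, tsum_eq_single c]
  · simp
  · intro c' hc'
    simp [hc']
  · intro d' hd'
    simp [hd']
  · intro j' _ hj'
    simp [hj']
  · simp
  · intro i' _ hi'
    simp [hi']
  · simp

/-- A measure described by `ν` is reversible as soon as the rates of steps from type `i` to type
`j` factor through a symmetric matrix and the offspring laws. -/
theorem Describes.reversible {ν : GW n} {μ : Measure (Tn n)} [IsFiniteMeasure μ]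
    (h : ν.Describes μ) (hdeg : ∀ᵐ t ∂μ, 0 < degree t) (K : Fin n → Fin n → ℝ≥0∞)
    (hK : ∀ i j, K i j = K j i) (hμ : ∀ i j d, edgeMass μ i j d = K i j * ν.offspring i d) :
    Reversible μ := by
  refine ⟨hdeg, fun A B hA hB => ?_⟩
  rw [h.flow hA hB, h.flow hB hA, Finset.sum_comm]
  refine Finset.sum_congr rfl fun j _ => Finset.sum_congr rfl fun i _ => ?_
  rw [ENNReal.tsum_comm]
  refine tsum_congr fun c => tsum_congr fun d => ?_
  rw [hμ, hμ, hK i j, ν.joinProb_swap i j d c hA hB]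
  ring

end GW

theorem IsReversibleFor.edgeMass_mul_eq {ν : GW n} {μ : Measure (Tn n)}
    (h : IsReversibleFor ν μ) (i j : Fin n) (d c : Fin n → ℕ) :
    GW.edgeMass μ i j d * ν.offspring j c = GW.edgeMass μ j i c * ν.offspring i d := by
  have := h.1
  rw [← h.2.2.edgeMass_mul, ← h.2.2.edgeMass_mul]
  exact h.2.1.2 _ _ (measurableSet_Nc _ _) (measurableSet_Nc _ _)

/-! ### Multinomial laws -/

/-- The multinomial probability of `c` with parameters `P`. -/
noncomputable def multi (P : Fin n → ℝ) (c : Fin n → ℕ) : ℝ :=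
  Nat.multinomial Finset.univ c * ∏ k, P k ^ c k

theorem sum_multi (P : Fin n → ℝ) (hP : ∑ k, P k = 1) (m : ℕ) :
    ∑ c ∈ Finset.piAntidiag Finset.univ m, multi P c = 1 := by
  have := Finset.sum_pow_eq_sum_piAntidiag Finset.univ P m
  rw [hP, one_pow] at this
  exact this.symm

theorem coe_piAntidiag (m : ℕ) :
    ((Finset.piAntidiag Finset.univ m : Finset (Fin n → ℕ)) : Set (Fin n → ℕ)) = ofSize m := by
  ext c
  simp [ofSize, Finset.mem_piAntidiag]

theorem prod_add_single (d : Fin n → ℕ) (j : Fin n) {M : Type*} [CommMonoid M]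
    (F : Fin n → ℕ → M) (a : M) (hF : F j (d j + 1) = a * F j (d j)) :
    ∏ k, F k ((d + Pi.single j 1 : Fin n → ℕ) k) = a * ∏ k, F k (d k) := by
  rw [← Finset.mul_prod_erase _ _ (Finset.mem_univ j),
    ← Finset.mul_prod_erase _ (fun k => F k (d k)) (Finset.mem_univ j), ← mul_assoc, ← hF]
  refine congrArg₂ (· * ·) (by simp) (Finset.prod_congr rfl fun k hk => ?_)
  simp [Finset.ne_of_mem_erase hk]

theorem prod_factorial_add_single (d : Fin n → ℕ) (j : Fin n) :
    ∏ k, (((d + Pi.single j 1 : Fin n → ℕ) k).factorial : ℝ) =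
      (d j + 1) * ∏ k, ((d k).factorial : ℝ) :=
  prod_add_single d j (fun _ m => (m.factorial : ℝ)) _ (by rw [Nat.factorial_succ]; push_cast; ring)

theorem prod_pow_add_single (P : Fin n → ℝ) (d : Fin n → ℕ) (j : Fin n) :
    ∏ k, P k ^ (d + Pi.single j 1 : Fin n → ℕ) k = P j * ∏ k, P k ^ d k :=
  prod_add_single d j (fun k m => P k ^ m) _ (by rw [pow_succ'])

theorem prod_factorial_ne_zero (c : Fin n → ℕ) : ∏ k, ((c k).factorial : ℝ) ≠ 0 :=
  Finset.prod_ne_zero_iff.2 fun _ _ => Nat.cast_ne_zero.2 (Nat.factorial_ne_zero _)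

theorem multi_eq (P : Fin n → ℝ) (c : Fin n → ℕ) :
    multi P c = ((∑ k, c k).factorial : ℝ) / (∏ k, ((c k).factorial : ℝ)) * ∏ k, P k ^ c k := by
  rw [multi, ← Nat.multinomial_spec Finset.univ c]
  push_cast
  rw [mul_div_cancel_left₀ _ (prod_factorial_ne_zero c)]

theorem multi_add_single (P : Fin n → ℝ) (d : Fin n → ℕ) (j : Fin n) :
    (d j + 1) * multi P (d + Pi.single j 1) = (∑ k, d k + 1 : ℕ) * (P j * multi P d) := by
  have h1 := prod_factorial_ne_zero d
  have h2 : (d j + 1 : ℝ) ≠ 0 := by positivity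
  rw [multi_eq, multi_eq, prod_factorial_add_single, prod_pow_add_single, GW.sum_add_single,
    Nat.factorial_succ]
  push_cast
  field_simp

theorem multi_single (P : Fin n → ℝ) (k : Fin n) (m : ℕ) : multi P (Pi.single k m) = P k ^ m := by
  rw [multi_eq]
  have h1 : ∀ j, (((Pi.single k m : Fin n → ℕ) j).factorial : ℝ) =
      if j = k then (m.factorial : ℝ) else 1 := by
    intro j
    by_cases h : j = k
    · subst h; simp
    · simp [h]
  have h2 : ∀ j, P j ^ (Pi.single k m : Fin n → ℕ) j = if j = k then P k ^ m else 1 := by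
    intro j
    by_cases h : j = k
    · subst h; simp
    · simp [h]
  simp_rw [h1, h2]
  rw [Finset.prod_ite_eq', Finset.prod_ite_eq']
  simp [Nat.factorial_ne_zero]

/-- A function on vectors for which replacing one element of type `j` by one of type `k` changes
the value in the same proportion as for a multinomial law is a multinomial law for every size, up
to normalization. -/
theorem exists_eq_mul_multi (Q : (Fin n → ℕ) → ℝ) (P : Fin n → ℝ) {j₀ : Fin n} (hP : P j₀ ≠ 0)
    (h : ∀ (d : Fin n → ℕ) (j k : Fin n), (d j + 1) * Q (d + Pi.single j 1) * P k =
      (d k + 1) * Q (d + Pi.single k 1) * P j) :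
    ∃ C : ℕ → ℝ, ∀ c, Q c = C (∑ k, c k) * multi P c := by
  -- Up to the factorials, an element of type `k` can be exchanged for one of type `j₀` at the cost
  -- of a factor `P k / P j₀`; after all exchanges only elements of type `j₀` are left.
  let f : (Fin n → ℕ) → ℝ := fun c => Q c * ∏ k, ((c k).factorial : ℝ)
  have hf : ∀ (d : Fin n → ℕ) (j k : Fin n),
      f (d + Pi.single j 1) * P k = f (d + Pi.single k 1) * P j := by
    intro d j k
    simp only [f, prod_factorial_add_single]
    linear_combination (∏ k, ((d k).factorial : ℝ)) * h d j k
  have key : ∀ (r : ℕ) (c : Fin n → ℕ), ∑ k ∈ Finset.univ.erase j₀, c k = r →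
      f c * P j₀ ^ (∑ k, c k) = (∏ k, P k ^ c k) * f (Pi.single j₀ (∑ k, c k)) := by
    intro r
    induction r with
    | zero =>
      intro c hc
      have hc0 : c = Pi.single j₀ (c j₀) := by
        funext k
        by_cases hk : k = j₀
        · subst hk; simp
        · have := (Finset.sum_eq_zero_iff.1 hc) k (by simp [hk])
          simp [hk, this]
      rw [hc0]
      have h2 : ∀ j, P j ^ (Pi.single j₀ (c j₀) : Fin n → ℕ) j =
          if j = j₀ then P j₀ ^ c j₀ else 1 := by
        intro j
        by_cases h : j = j₀
        · subst h; simp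
        · simp [h]
      simp_rw [h2]
      rw [Finset.prod_ite_eq']
      simp [mul_comm]
    | succ r ih =>
      intro c hc
      obtain ⟨k, hk, hck⟩ : ∃ k ∈ Finset.univ.erase j₀, c k ≠ 0 := by
        by_contra! hall
        rw [Finset.sum_eq_zero hall] at hc
        omega
      have hkj : k ≠ j₀ := Finset.ne_of_mem_erase hk
      obtain ⟨d, rfl⟩ := GW.exists_eq_add_single hck
      have hd := ih (d + Pi.single j₀ 1) (by
        simp only [Pi.add_apply, Finset.sum_add_distrib] at hc ⊢
        rw [Finset.sum_pi_single'] at hc ⊢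
        simp only [hk, if_true] at hc
        simp
        omega)
      rw [GW.sum_add_single, prod_pow_add_single] at hd ⊢
      have := hf d k j₀
      apply mul_right_cancel₀ hP
      linear_combination P j₀ ^ (∑ k, d k + 1) * this + P k * hd
  refine ⟨fun m => f (Pi.single j₀ m) / (P j₀ ^ m * m.factorial), fun c => ?_⟩
  have h1 := key _ c rfl
  have h2 := prod_factorial_ne_zero c
  have h3 : P j₀ ^ (∑ k, c k) ≠ 0 := pow_ne_zero _ hP
  have h4 : ((∑ k, c k).factorial : ℝ) ≠ 0 := Nat.cast_ne_zero.2 (Nat.factorial_ne_zero _)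
  rw [multi_eq]
  field_simp
  simp only [f] at h1 ⊢
  linear_combination h1

namespace GW

/-- The probability that an individual of type `i` has `m` children. -/
noncomputable def sizeProb (ν : GW n) (i : Fin n) (m : ℕ) : ℝ≥0∞ :=
  (ν.offspring i).toMeasure (ofSize m)

theorem measurableSet_vec (s : Set (Fin n → ℕ)) : MeasurableSet s :=
  (Set.to_countable s).measurableSet

theorem sizeProb_eq_sum (ν : GW n) (i : Fin n) (m : ℕ) :
    ν.sizeProb i m = ∑ c ∈ Finset.piAntidiag Finset.univ m, ν.offspring i c := by
  rw [sizeProb, ← coe_piAntidiag, ← sum_measure_singleton]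
  exact Finset.sum_congr rfl fun c _ =>
    PMF.toMeasure_apply_singleton _ _ (measurableSet_singleton c)

theorem sizeProb_eq_tsum (ν : GW n) (i : Fin n) (m : ℕ) :
    ν.sizeProb i m = ∑' c, (ofSize m).indicator (ν.offspring i) c :=
  PMF.toMeasure_apply _ (measurableSet_vec _)

theorem sizeProb_ne_top (ν : GW n) (i : Fin n) (m : ℕ) : ν.sizeProb i m ≠ ∞ := measure_ne_top _ _

theorem mem_D_iff (ρ : Measure (Fin n → ℕ)) (m : ℕ) : m ∈ D ρ ↔ ρ (ofSize m) ≠ 0 := by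
  rw [← coe_piAntidiag, ← sum_measure_singleton, Ne, Finset.sum_eq_zero_iff]
  push Not
  change (∃ c ∈ ofSize m, 0 < ρ {c}) ↔ _
  rw [← coe_piAntidiag]
  simp only [Finset.mem_coe, pos_iff_ne_zero]

/-- Multinomial offspring, without conditioning on the number of children. -/
theorem StronglyConnected.hasMultinomialOffspring_iff {ν : GW n} (hν : ν.StronglyConnected)
    (p : Fin n → Fin n → ℝ) : HasMultinomialOffspring ν p ↔
      (∀ i j, 0 ≤ p i j) ∧ (∀ i, ∑ j, p i j = 1) ∧
      ∀ i c, ν.offspring i c = ν.sizeProb i (∑ k, c k) * ENNReal.ofReal (multi (p i) c) := by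
  refine and_congr_right fun _ => and_congr_right fun _ => forall_congr' fun i => ?_
  have hcond : ∀ c m, c ∈ ofSize m →
      ProbabilityTheory.cond (nbrLaw ν.law i) (ofSize m) {c} =
        (ν.sizeProb i m)⁻¹ * ν.offspring i c := by
    intro c m hc
    rw [hν.nbrLaw_law, ProbabilityTheory.cond_apply (measurableSet_vec _),
      inter_eq_right.2 (singleton_subset_iff.2 hc),
      PMF.toMeasure_apply_singleton _ _ (measurableSet_singleton c)]
    rfl
  simp only [mem_D_iff]
  have hs : ∀ m, nbrLaw ν.law i (ofSize m) = ν.sizeProb i m := fun m => by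
    rw [hν.nbrLaw_law]; rfl
  simp only [hs]
  constructor
  · intro h c
    by_cases h0 : ν.sizeProb i (∑ k, c k) = 0
    · rw [h0, zero_mul]
      rw [sizeProb_eq_sum, Finset.sum_eq_zero_iff] at h0
      exact h0 c (by simp [Finset.mem_piAntidiag])
    · have := h _ h0 c rfl
      rw [hcond c _ rfl] at this
      change _ = ENNReal.ofReal (multi (p i) c) at this
      rw [← this, ← mul_assoc, ENNReal.mul_inv_cancel h0 (ν.sizeProb_ne_top _ _), one_mul]
  · intro h m hm c hc
    rw [hcond c m hc, h c, show ∑ k, c k = m from hc, ← mul_assoc,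
      ENNReal.inv_mul_cancel hm (ν.sizeProb_ne_top _ _), one_mul]
    rfl

end GW

/-! ### The root of a reversible tree -/

namespace GW

/-- The probability that the root has type `i` and that the walk steps to a neighbour of
type `j`. -/
noncomputable def flux (μ : Measure (Tn n)) (i j : Fin n) : ℝ≥0∞ := ∑' d, edgeMass μ i j d

/-- The vector of neighbours seen from the root is recovered by summing over the possible types of
the next step. -/
theorem sum_edgeMass (μ : Measure (Tn n)) (i : Fin n) (F : (Fin n → ℕ) → ℝ≥0∞) :
    ∑ j, ∑' d, edgeMass μ i j d * F (d + Pi.single j 1) =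
      ∑' c, if c = 0 then 0 else μ (Nc i c) * F c := by
  have h1 : ∀ j, ∑' d, edgeMass μ i j d * F (d + Pi.single j 1) =
      ∑' c : Fin n → ℕ, (c j : ℝ≥0∞) * (μ (Nc i c) / ((∑ k, c k : ℕ) : ℝ≥0∞) * F c) := by
    intro j
    rw [tsum_mul_eq_tsum_add_single j fun c => μ (Nc i c) / ((∑ k, c k : ℕ) : ℝ≥0∞) * F c]
    exact tsum_congr fun d => mul_assoc _ _ _
  simp_rw [h1]
  rw [← Summable.tsum_finsetSum fun _ _ => ENNReal.summable]
  refine tsum_congr fun c => ?_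
  rw [← Finset.sum_mul, ← Nat.cast_sum]
  split_ifs with hc
  · simp [hc]
  · have : ((∑ k, c k : ℕ) : ℝ≥0∞) ≠ 0 := by
      rw [Nat.cast_ne_zero]
      intro h
      exact hc (funext fun k => Finset.sum_eq_zero_iff.1 h k (Finset.mem_univ k))
    rw [← mul_assoc, ENNReal.mul_div_cancel this (ENNReal.natCast_ne_top _)]

theorem tsum_Nc (μ : Measure (Tn n)) (i : Fin n) (s : Set (Fin n → ℕ)) :
    ∑' c, μ (Nc i c) * s.indicator 1 c = μ (N i ∩ nbrCount ⁻¹' s) := by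
  have : N i ∩ nbrCount ⁻¹' s = ⋃ c : s, Nc i c := by
    ext t
    simp only [mem_iUnion]
    exact ⟨fun h => ⟨⟨_, h.2⟩, h.1, rfl⟩,
      fun ⟨c, h1, h2⟩ => ⟨h1, by rw [mem_preimage, h2]; exact c.2⟩⟩
  rw [this, measure_iUnion (f := fun c : s => Nc i c) (fun c d hcd => Set.disjoint_left.2
    fun t hc hd => hcd (Subtype.ext ((show nbrCount t = c from hc.2).symm.trans hd.2)))
    fun c => measurableSet_Nc i c, tsum_subtype s fun c => μ (Nc i c)]
  refine tsum_congr fun c => ?_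
  by_cases hc : c ∈ s <;> simp [hc]

theorem sum_measure_N (μ : Measure (Tn n)) : ∑ i, μ (N i) = μ univ := by
  rw [← measure_biUnion_finset (f := N) (fun i _ j _ hij => Set.disjoint_left.2 fun t hi hj =>
    hij ((show rootLabel t = i from hi).symm.trans hj)) fun i _ => measurableSet_N i]
  congr 1
  exact eq_univ_of_forall fun t => mem_biUnion (Finset.mem_univ (rootLabel t)) rfl

end GW

section reversible

open GW

variable {ν : GW n} {μ : Measure (Tn n)}

/-- Summing the reversibility relation over the offspring at the other end of the edge. -/
theorem IsReversibleFor.edgeMass_eq (h : IsReversibleFor ν μ) (i j : Fin n) (d : Fin n → ℕ) :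
    edgeMass μ i j d = flux μ i j * ν.offspring i d := by
  have key : ∀ i j d, edgeMass μ i j d = flux μ j i * ν.offspring i d := by
    intro i j d
    have := tsum_congr (L := .unconditional _) fun c => h.edgeMass_mul_eq i j d c
    rwa [ENNReal.tsum_mul_left, PMF.tsum_coe, mul_one, ENNReal.tsum_mul_right] at this
  have hsymm : flux μ i j = flux μ j i := by
    rw [flux, tsum_congr fun d => key i j d, ENNReal.tsum_mul_left, PMF.tsum_coe, mul_one]
  rw [key, hsymm]

theorem IsReversibleFor.flux_comm (h : IsReversibleFor ν μ) (i j : Fin n) :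
    flux μ i j = flux μ j i := by
  obtain ⟨d, hd⟩ := (ν.offspring i).support_nonempty
  obtain ⟨c, hc⟩ := (ν.offspring j).support_nonempty
  have := h.edgeMass_mul_eq i j d c
  rw [h.edgeMass_eq, h.edgeMass_eq, mul_assoc, mul_assoc, mul_comm (ν.offspring j c)] at this
  refine (ENNReal.mul_left_inj (mul_ne_zero hd hc) ?_).1 this
  exact ENNReal.mul_ne_top (PMF.apply_ne_top _ _) (PMF.apply_ne_top _ _)

theorem IsReversibleFor.measure_Nc_zero (h : IsReversibleFor ν μ) (i : Fin n) :
    μ (Nc i 0) = 0 := by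
  rw [measure_eq_zero_iff_ae_notMem]
  filter_upwards [h.2.1.1] with t ht ht'
  rw [degree, ht'.2] at ht
  simp at ht

theorem IsReversibleFor.sum_flux (h : IsReversibleFor ν μ) (i : Fin n)
    (F : (Fin n → ℕ) → ℝ≥0∞) :
    ∑ j, flux μ i j * ∑' d, ν.offspring i d * F (d + Pi.single j 1) =
      ∑' c, μ (Nc i c) * F c := by
  have : ∀ c, μ (Nc i c) * F c = if c = 0 then 0 else μ (Nc i c) * F c := by
    intro c
    split_ifs with hc
    · rw [hc, h.measure_Nc_zero, zero_mul]
    · rfl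
  rw [tsum_congr this, ← sum_edgeMass]
  refine Finset.sum_congr rfl fun j _ => ?_
  rw [← ENNReal.tsum_mul_left]
  refine tsum_congr fun d => ?_
  rw [h.edgeMass_eq, mul_assoc]

theorem IsReversibleFor.sum_flux_eq (h : IsReversibleFor ν μ) (i : Fin n) :
    ∑ j, flux μ i j = μ (N i) := by
  have h1 := h.sum_flux i 1
  have h2 := tsum_Nc μ i univ
  rw [indicator_univ] at h2
  rw [h2] at h1
  simpa [PMF.tsum_coe] using h1

theorem IsReversibleFor.measure_size (h : IsReversibleFor ν μ) (i : Fin n) (m : ℕ) :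
    μ (N i ∩ nbrCount ⁻¹' ofSize (m + 1)) = μ (N i) * ν.sizeProb i m := by
  rw [← tsum_Nc, ← h.sum_flux, ← h.sum_flux_eq, Finset.sum_mul]
  refine Finset.sum_congr rfl fun j _ => ?_
  rw [sizeProb_eq_tsum]
  congr 1
  refine tsum_congr fun d => ?_
  have : d + Pi.single j 1 ∈ (ofSize (m + 1) : Set (Fin n → ℕ)) ↔ d ∈ ofSize m := by
    simp only [ofSize, mem_ofPred_eq, sum_add_single, Nat.add_right_cancel_iff]
  by_cases hd : d ∈ (ofSize m : Set (Fin n → ℕ))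
  · simp [hd, this.2 hd]
  · simp [hd, mt this.1 hd]

theorem IsReversibleFor.flux_ne_top (h : IsReversibleFor ν μ) (i j : Fin n) :
    flux μ i j ≠ ∞ := by
  have := h.1
  refine ne_top_of_le_ne_top (measure_ne_top μ (N i)) ?_
  rw [← h.sum_flux_eq]
  exact Finset.single_le_sum (f := fun j => flux μ i j) (fun _ _ => zero_le) (Finset.mem_univ j)

/-- If the root can have type `i`, and an individual of type `i` can have a child of type `j`, then
the walk steps from type `i` to type `j` with positive probability. -/
theorem IsReversibleFor.flux_ne_zero_of_step (h : IsReversibleFor ν μ) {i j : Fin n}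
    (hi : μ (N i) ≠ 0) (hij : ν.Step i j) : flux μ i j ≠ 0 := by
  obtain ⟨c, hc, hcj⟩ := hij
  rw [← h.sum_flux_eq] at hi
  obtain ⟨k, -, hk⟩ := Finset.exists_ne_zero_of_sum_ne_zero hi
  have h1 : edgeMass μ i k c ≠ 0 := by
    rw [h.edgeMass_eq]
    exact mul_ne_zero hk hc
  have h2 : μ (Nc i (c + Pi.single k 1)) ≠ 0 := by
    intro h0
    apply h1
    rw [edgeMass, h0, ENNReal.zero_div, mul_zero]
  -- A child of type `j` in `c` can serve as the marked neighbour instead of the added one.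
  obtain ⟨d, hd⟩ := exists_eq_add_single (c := c + Pi.single k 1) (j := j)
    (Nat.add_pos_left hcj _).ne'
  have h4 : edgeMass μ i j d ≠ 0 := by
    rw [edgeMass, ← hd]
    refine mul_ne_zero (by simp) (ENNReal.div_ne_zero.2 ⟨h2, ENNReal.natCast_ne_top _⟩)
  rw [h.edgeMass_eq] at h4
  exact left_ne_zero_of_mul h4

theorem IsReversibleFor.measure_N_ne_zero_of_flux (h : IsReversibleFor ν μ) {i j : Fin n}
    (hij : flux μ i j ≠ 0) : μ (N j) ≠ 0 := by
  rw [← h.sum_flux_eq]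
  intro h0
  rw [h.flux_comm] at hij
  exact hij (Finset.sum_eq_zero_iff.1 h0 i (Finset.mem_univ i))

theorem IsReversibleFor.measure_N_ne_zero (h : IsReversibleFor ν μ) (hν : ν.StronglyConnected)
    (j : Fin n) : μ (N j) ≠ 0 := by
  have := h.1
  obtain ⟨i, -, hi⟩ : ∃ i ∈ Finset.univ, μ (N i) ≠ 0 := by
    apply Finset.exists_ne_zero_of_sum_ne_zero
    rw [sum_measure_N, measure_univ]
    exact one_ne_zero
  induction hν.reachable i j with
  | refl => exact hi
  | tail _ hs ih => exact h.measure_N_ne_zero_of_flux (h.flux_ne_zero_of_step ih hs)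

/-- The root has one more neighbour than an individual of the same type has children. -/
theorem IsReversibleFor.nbrLaw_apply (h : IsReversibleFor ν μ) (hν : ν.StronglyConnected)
    (i : Fin n) (m : ℕ) : nbrLaw μ i (ofSize (m + 1)) = nbrLaw ν.law i (ofSize m) := by
  have := h.1
  rw [hν.nbrLaw_law, nbrLaw, Measure.map_apply measurable_nbrCount (measurableSet_vec _),
    ProbabilityTheory.cond_apply (measurableSet_N i), h.measure_size, ← mul_assoc,
    ENNReal.inv_mul_cancel (h.measure_N_ne_zero hν i) (measure_ne_top _ _), one_mul]
  rfl

/-- The probability, given that the root has type `i`, that the walk steps to a neighbour of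
type `j`. -/
noncomputable def stepMatrix (μ : Measure (Tn n)) (i j : Fin n) : ℝ :=
  (flux μ i j).toReal / μ.real (N i)

theorem IsReversibleFor.real_N_pos (h : IsReversibleFor ν μ) (hν : ν.StronglyConnected)
    (i : Fin n) : 0 < μ.real (N i) := by
  have := h.1
  exact ENNReal.toReal_pos (h.measure_N_ne_zero hν i) (measure_ne_top _ _)

theorem IsReversibleFor.flux_toReal (h : IsReversibleFor ν μ) (hν : ν.StronglyConnected)
    (i j : Fin n) : (flux μ i j).toReal = μ.real (N i) * stepMatrix μ i j :=
  (mul_div_cancel₀ _ (h.real_N_pos hν i).ne').symm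

theorem IsReversibleFor.detailed_balance (h : IsReversibleFor ν μ) (hν : ν.StronglyConnected)
    (i j : Fin n) :
    μ.real (N i) * stepMatrix μ i j = μ.real (N j) * stepMatrix μ j i := by
  rw [← h.flux_toReal hν, ← h.flux_toReal hν, h.flux_comm]

theorem IsReversibleFor.sum_stepMatrix (h : IsReversibleFor ν μ) (hν : ν.StronglyConnected)
    (i : Fin n) : ∑ j, stepMatrix μ i j = 1 := by
  simp only [stepMatrix]
  rw [← Finset.sum_div, ← ENNReal.toReal_sum fun j _ => h.flux_ne_top i j, h.sum_flux_eq]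
  exact div_self (h.real_N_pos hν i).ne'

theorem stepMatrix_nonneg (μ : Measure (Tn n)) (i j : Fin n) : 0 ≤ stepMatrix μ i j :=
  div_nonneg ENNReal.toReal_nonneg measureReal_nonneg

/-- Both sides are, up to the same factor, the probability that a root of type `i` has neighbours
`d + e_j + e_k`, computed by marking the element `k` or the element `j`. -/
theorem IsReversibleFor.exchange (h : IsReversibleFor ν μ) (hν : ν.StronglyConnected) (i : Fin n)
    (d : Fin n → ℕ) (j k : Fin n) :
    (d j + 1) * (ν.offspring i (d + Pi.single j 1)).toReal * stepMatrix μ i k =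
      (d k + 1) * (ν.offspring i (d + Pi.single k 1)).toReal * stepMatrix μ i j := by
  rcases eq_or_ne j k with rfl | hjk
  · rfl
  have hw := (h.real_N_pos hν i).ne'
  have key : ∀ j k : Fin n, j ≠ k → μ.real (N i) *
      ((d j + 1) * (ν.offspring i (d + Pi.single j 1)).toReal * stepMatrix μ i k) =
      (d j + 1) * (d k + 1) * (μ (Nc i (d + Pi.single j 1 + Pi.single k 1)) /
        ((∑ l, (d + Pi.single j 1 + Pi.single k 1 : Fin n → ℕ) l : ℕ) : ℝ≥0∞)).toReal := by
    intro j k hjk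
    have h1 := congrArg ENNReal.toReal (h.edgeMass_eq i k (d + Pi.single j 1))
    rw [edgeMass, ENNReal.toReal_mul, ENNReal.toReal_mul, h.flux_toReal hν] at h1
    have h2 : (((d + Pi.single j 1 : Fin n → ℕ) k : ℝ≥0∞) + 1).toReal = d k + 1 := by
      rw [ENNReal.toReal_add (ENNReal.natCast_ne_top _) ENNReal.one_ne_top]
      simp [hjk.symm]
    rw [h2] at h1
    linear_combination -(d j + 1 : ℝ) * h1
  apply mul_left_cancel₀ hw
  rw [key j k hjk, key k j hjk.symm, add_right_comm d]
  ring

/-- The offspring laws of a measure that admits a reversible companion are multinomial. -/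
theorem IsReversibleFor.hasMultinomialOffspring (h : IsReversibleFor ν μ)
    (hν : ν.StronglyConnected) : HasMultinomialOffspring ν (stepMatrix μ) := by
  rw [hν.hasMultinomialOffspring_iff]
  refine ⟨stepMatrix_nonneg μ, h.sum_stepMatrix hν, fun i c => ?_⟩
  obtain ⟨j₀, -, hj₀⟩ : ∃ j ∈ Finset.univ, stepMatrix μ i j ≠ 0 := by
    apply Finset.exists_ne_zero_of_sum_ne_zero
    rw [h.sum_stepMatrix hν]
    exact one_ne_zero
  obtain ⟨C, hC⟩ := exists_eq_mul_multi (fun c => (ν.offspring i c).toReal) (stepMatrix μ i) hj₀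
    fun d j k => h.exchange hν i d j k
  have hsize : (ν.sizeProb i (∑ k, c k)).toReal = C (∑ k, c k) := by
    rw [sizeProb_eq_sum, ENNReal.toReal_sum fun c _ => PMF.apply_ne_top _ _,
      ← mul_one (C _), ← sum_multi _ (h.sum_stepMatrix hν i) (∑ k, c k), Finset.mul_sum]
    refine Finset.sum_congr rfl fun c' hc' => ?_
    have := hC c'
    rwa [(Finset.mem_piAntidiag.1 hc').1] at this
  rw [← ENNReal.ofReal_toReal (PMF.apply_ne_top (ν.offspring i) c), hC c, ← hsize,
    ENNReal.ofReal_mul ENNReal.toReal_nonneg, ENNReal.ofReal_toReal (ν.sizeProb_ne_top _ _)]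

theorem IsReversibleFor.stepMatrix_pos_symm (h : IsReversibleFor ν μ)
    (hν : ν.StronglyConnected) {i j : Fin n} (hij : 0 < stepMatrix μ i j) :
    0 < stepMatrix μ j i := by
  have h1 := mul_pos (h.real_N_pos hν i) hij
  rw [h.detailed_balance hν] at h1
  exact (pos_iff_pos_of_mul_pos h1).1 (h.real_N_pos hν j)

theorem IsReversibleFor.ratio_eq (h : IsReversibleFor ν μ) (hν : ν.StronglyConnected)
    {i j : Fin n} (hij : 0 < stepMatrix μ i j) :
    μ.real (N i) / μ.real (N j) = stepMatrix μ j i / stepMatrix μ i j := by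
  rw [div_eq_div_iff (h.real_N_pos hν j).ne' hij.ne', h.detailed_balance hν, mul_comm]

theorem IsReversibleFor.cycleCondition (h : IsReversibleFor ν μ) (hν : ν.StronglyConnected) :
    CycleCondition (stepMatrix μ) := by
  intro m x hx hpos
  have h1 : ∀ s ∈ Finset.range m, stepMatrix μ (x s) (x (s + 1)) / stepMatrix μ (x (s + 1)) (x s) =
      μ.real (N (x (s + 1))) / μ.real (N (x s)) := fun s hs =>
    (h.ratio_eq hν (h.stepMatrix_pos_symm hν (hpos s (Finset.mem_range.1 hs)))).symm
  have hne : ∀ s, μ.real (N (x s)) ≠ 0 := fun s => (h.real_N_pos hν _).ne'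
  have h2 : ∀ m, ∏ s ∈ Finset.range m, μ.real (N (x (s + 1))) / μ.real (N (x s)) =
      μ.real (N (x m)) / μ.real (N (x 0)) := by
    intro m
    induction m with
    | zero => simp [div_self (hne 0)]
    | succ m ih => rw [Finset.prod_range_succ, ih, mul_comm, div_mul_div_cancel₀ (hne m)]
  rw [Finset.prod_congr rfl h1, h2, hx, div_self (hne 0)]

theorem IsReversibleFor.rootEquations (h : IsReversibleFor ν μ) (hν : ν.StronglyConnected) :
    RootEquations (stepMatrix μ) fun i => μ.real (N i) := by
  have := h.1
  refine ⟨fun i j hij => h.ratio_eq hν hij, ?_⟩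
  have h1 := congrArg ENNReal.toReal (sum_measure_N μ)
  rwa [measure_univ, ENNReal.toReal_sum fun i _ => measure_ne_top _ _] at h1

end reversible

/-! ### Uniqueness -/

theorem HasMultinomialOffspring.pos_of_step {ν : GW n} {p : Fin n → Fin n → ℝ}
    (hp : HasMultinomialOffspring ν p) (hν : ν.StronglyConnected) {i j : Fin n}
    (hij : ν.Step i j) : 0 < p i j := by
  rw [hν.hasMultinomialOffspring_iff] at hp
  obtain ⟨c, hc, hcj⟩ := hij
  refine (hp.1 i j).lt_of_ne' fun h0 => hc ?_
  have : multi (p i) c = 0 := by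
    rw [multi, Finset.prod_eq_zero (Finset.mem_univ j), mul_zero]
    rw [h0, zero_pow hcj.ne']
  rw [hp.2.2, this, ENNReal.ofReal_zero, mul_zero]

theorem HasMultinomialOffspring.reachable {ν : GW n} {p : Fin n → Fin n → ℝ}
    (hp : HasMultinomialOffspring ν p) (hν : ν.StronglyConnected) (i j : Fin n) :
    Relation.ReflTransGen (fun a b => 0 < p a b) i j :=
  Relation.ReflTransGen.mono (fun _ _ => hp.pos_of_step hν) i j (hν.reachable i j)

/-- The parameters of the multinomial laws are determined by the Galton-Watson measure: the
probability that all of `m` children have type `k` is proportional to the `m`-th power of the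
parameter. If individuals of some type have no children, there is only one type. -/
theorem HasMultinomialOffspring.unique {ν : GW n} {p p' : Fin n → Fin n → ℝ}
    (hp : HasMultinomialOffspring ν p) (hp' : HasMultinomialOffspring ν p')
    (hν : ν.StronglyConnected) : p = p' := by
  rw [hν.hasMultinomialOffspring_iff] at hp hp'
  funext i k
  by_cases h : ∃ m, m ≠ 0 ∧ ν.sizeProb i m ≠ 0
  · obtain ⟨m, hm, hs⟩ := h
    have h1 := (hp.2.2 i (Pi.single k m)).symm.trans (hp'.2.2 i (Pi.single k m))
    have hsum : ∑ l, (Pi.single k m : Fin n → ℕ) l = m := by simp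
    rw [hsum, multi_single, multi_single, ENNReal.mul_right_inj hs (ν.sizeProb_ne_top i m),
      ENNReal.ofReal_eq_ofReal_iff (pow_nonneg (hp.1 i k) m) (pow_nonneg (hp'.1 i k) m)] at h1
    exact (pow_left_inj₀ (hp.1 i k) (hp'.1 i k) hm).1 h1
  · push Not at h
    have hstep : ∀ j, ¬ ν.Step i j := by
      rintro j ⟨c, hc, hcj⟩
      apply hc
      rw [hp.2.2, h, zero_mul]
      intro h0
      have := Finset.sum_eq_zero_iff.1 h0 j (Finset.mem_univ j)
      omega
    have huniq : ∀ j, j = i := by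
      intro j
      rcases (hν.reachable i j).cases_head with h | ⟨l, hl, -⟩
      · exact h.symm
      · exact absurd hl (hstep l)
    have hsum : ∀ q : Fin n → ℝ, ∑ j, q j = q k := by
      intro q
      rw [Finset.sum_eq_single k (fun j _ hj => absurd ((huniq j).trans (huniq k).symm) hj)
        fun h => absurd (Finset.mem_univ k) h]
    rw [← hsum (p i), ← hsum (p' i), hp.2.1, hp'.2.1]

/-- On a connected graph the equations for the law of the label of the root have at most one
solution. -/
theorem RootEquations.unique {p : Fin n → Fin n → ℝ} {w w' : Fin n → ℝ}
    (hreach : ∀ i j, Relation.ReflTransGen (fun a b => 0 < p a b) i j)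
    (hsymm : ∀ i j, 0 < p i j → 0 < p j i) (hw : RootEquations p w) (hw' : RootEquations p w')
    (hpos : ∀ i, 0 < w' i) : w = w' := by
  have key : ∀ i j, w i / w' i = w j / w' j := by
    intro i j
    induction hreach i j with
    | refl => rfl
    | @tail a b _ hab ih =>
      rw [ih]
      have h1 := hw.1 a b hab
      have h2 := hw'.1 a b hab
      have hr : p b a / p a b ≠ 0 := (div_pos (hsymm a b hab) hab).ne'
      have hb : w b ≠ 0 := by
        intro h0
        rw [h0, div_zero] at h1
        exact hr h1.symm
      have ha' := (hpos a).ne'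
      have hb' := (hpos b).ne'
      rw [← h2] at h1
      field_simp at h1 ⊢
      linear_combination h1
  funext i
  have h1 : ∀ j, w j = w i / w' i * w' j := fun j => by
    rw [key i j, div_mul_cancel₀ _ (hpos j).ne']
  have h2 : w i / w' i = 1 := by
    have := hw.2
    rw [Finset.sum_congr rfl fun j _ => h1 j, ← Finset.mul_sum, hw'.2, mul_one] at this
    exact this
  rw [h1 i, h2, one_mul]

/-! ### Weights satisfying detailed balance -/

/-- There is a walk from `a` to `b` along positive entries of `p` on which the product of the ratios
of `p` along and against the steps is `r`. -/
inductive WalkRatio (p : Fin n → Fin n → ℝ) (a : Fin n) : Fin n → ℝ → Prop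
  | nil : WalkRatio p a a 1
  | snoc {b c r} : WalkRatio p a b r → 0 < p b c → WalkRatio p a c (r * (p b c / p c b))

theorem WalkRatio.trans {p : Fin n → Fin n → ℝ} {a b c : Fin n} {r s : ℝ}
    (h : WalkRatio p a b r) (h' : WalkRatio p b c s) : WalkRatio p a c (r * s) := by
  induction h' with
  | nil => rwa [mul_one]
  | snoc _ hp ih =>
    rw [← mul_assoc]
    exact ih.snoc hp

theorem WalkRatio.exists_seq {p : Fin n → Fin n → ℝ} {a b : Fin n} {r : ℝ}
    (h : WalkRatio p a b r) : ∃ (m : ℕ) (x : ℕ → Fin n), x 0 = a ∧ x m = b ∧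
      (∀ s < m, 0 < p (x s) (x (s + 1))) ∧
      ∏ s ∈ Finset.range m, p (x s) (x (s + 1)) / p (x (s + 1)) (x s) = r := by
  induction h with
  | nil => exact ⟨0, fun _ => a, rfl, rfl, by simp, by simp⟩
  | @snoc b c r _ hp ih =>
    obtain ⟨m, x, h0, hm, hpos, hprod⟩ := ih
    have hx : ∀ s ≤ m, Function.update x (m + 1) c s = x s := fun s hs =>
      Function.update_of_ne (by omega) _ _
    have hx' : Function.update x (m + 1) c (m + 1) = c := Function.update_self _ _ _
    refine ⟨m + 1, Function.update x (m + 1) c, ?_, hx', fun s hs => ?_, ?_⟩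
    · rw [hx 0 (Nat.zero_le m), h0]
    · rcases Nat.lt_succ_iff_lt_or_eq.1 hs with hs | rfl
      · rw [hx s hs.le, hx (s + 1) hs]
        exact hpos s hs
      · rw [hx s le_rfl, hx', hm]
        exact hp
    · rw [Finset.prod_range_succ, hx m le_rfl, hx', hm, ← hprod]
      congr 1
      refine Finset.prod_congr rfl fun s hs => ?_
      have hs' := Finset.mem_range.1 hs
      rw [hx s hs'.le, hx (s + 1) hs']

theorem CycleCondition.walkRatio_eq_one {p : Fin n → Fin n → ℝ} (hc : CycleCondition p)
    {a : Fin n} {r : ℝ} (h : WalkRatio p a a r) : r = 1 := by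
  obtain ⟨m, x, h0, hm, hpos, rfl⟩ := h.exists_seq
  exact hc m x (hm.trans h0.symm) hpos

theorem exists_walkRatio {p : Fin n → Fin n → ℝ} {a b : Fin n}
    (h : Relation.ReflTransGen (fun a b => 0 < p a b) a b) : ∃ r, WalkRatio p a b r := by
  induction h with
  | refl => exact ⟨1, .nil⟩
  | tail _ hp ih =>
    obtain ⟨r, hr⟩ := ih
    exact ⟨_, hr.snoc hp⟩

/-- Kolmogorov's criterion: the cycle condition provides weights in detailed balance, the weight of
`b` being the product of the ratios along any walk from a fixed type to `b`. -/
theorem CycleCondition.exists_weights {p : Fin n → Fin n → ℝ} (hc : CycleCondition p)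
    (hnn : ∀ i j, 0 ≤ p i j) (hreach : ∀ i j, Relation.ReflTransGen (fun a b => 0 < p a b) i j)
    (o : Fin n) : ∃ w : Fin n → ℝ, (∀ i, 0 < w i) ∧ (∀ i j, w i * p i j = w j * p j i) ∧
      ∑ i, w i = 1 := by
  have hsymm : ∀ i j, 0 < p i j → 0 < p j i := by
    intro i j hij
    obtain ⟨r, hr⟩ := exists_walkRatio (hreach j i)
    have := hc.walkRatio_eq_one (((WalkRatio.nil).snoc hij).trans hr)
    refine (hnn j i).lt_of_ne' fun h0 => ?_
    rw [h0, div_zero, mul_zero, zero_mul] at this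
    exact zero_ne_one this
  have hfun : ∀ {i : Fin n} {r s : ℝ}, WalkRatio p o i r → WalkRatio p o i s → r = s := by
    intro i r s hr hs
    obtain ⟨t, ht⟩ := exists_walkRatio (hreach i o)
    have h1 := hc.walkRatio_eq_one (hr.trans ht)
    have h2 := hc.walkRatio_eq_one (hs.trans ht)
    have ht0 : t ≠ 0 := by
      rintro rfl
      simp at h1
    exact mul_right_cancel₀ ht0 (h1.trans h2.symm)
  have hpos : ∀ {i : Fin n} {r : ℝ}, WalkRatio p o i r → 0 < r := by
    intro i r hr
    induction hr with
    | nil => exact one_pos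
    | snoc _ hp ih => exact mul_pos ih (div_pos hp (hsymm _ _ hp))
  choose w hw using fun i => exists_walkRatio (hreach o i)
  have hbal : ∀ i j, 0 < p i j → w i * p i j = w j * p j i := by
    intro i j hij
    have h1 := hfun (hw j) ((hw i).snoc hij)
    rw [h1, ← mul_div_assoc, div_mul_cancel₀ _ (hsymm i j hij).ne']
  have hsum : 0 < ∑ i, w i := Finset.sum_pos (fun i _ => hpos (hw i)) ⟨o, Finset.mem_univ o⟩
  refine ⟨fun i => w i / ∑ j, w j, fun i => div_pos (hpos (hw i)) hsum, fun i j => ?_, ?_⟩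
  · have : w i * p i j = w j * p j i := by
      rcases (hnn i j).eq_or_lt with h | h
      · rcases (hnn j i).eq_or_lt with h' | h'
        · rw [← h, ← h', mul_zero, mul_zero]
        · exact absurd (hsymm j i h') h.symm.le.not_gt
      · exact hbal i j h
    rw [div_mul_eq_mul_div, div_mul_eq_mul_div, this]
  · rw [← Finset.sum_div, div_self hsum.ne']

/-! ### The reversible measure -/

namespace GW

/-- The probability that the root has type `i` and neighbours `c`, for the reversible measure with
law `w` of the type of the root: the neighbours of a root of type `i` are distributed as its
children, except that there is one more of them. The subtraction is only used for `c ≠ 0`, where it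
is not truncated. -/
noncomputable def rootWeight (ν : GW n) (p : Fin n → Fin n → ℝ) (w : Fin n → ℝ) (i : Fin n)
    (c : Fin n → ℕ) : ℝ≥0∞ :=
  if c = 0 then 0 else
    ENNReal.ofReal (w i) * (ν.sizeProb i (∑ k, c k - 1) * ENNReal.ofReal (multi (p i) c))

/-- The measure under which the root and its neighbours are distributed according to `rootWeight`,
and the descendant subtrees of the neighbours are independent Galton-Watson trees. -/
noncomputable def reversibleMeasure (ν : GW n) (p : Fin n → Fin n → ℝ) (w : Fin n → ℝ) :
    Measure (Tn n) :=
  Measure.sum fun q : Fin n × (Fin n → ℕ) => rootWeight ν p w q.1 q.2 • ν.graftLaw q.1 q.2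

variable {ν : GW n} {p : Fin n → Fin n → ℝ} {w : Fin n → ℝ}

theorem reversibleMeasure_Nc_inter (i : Fin n) (c : Fin n → ℕ) {A : Set (Tn n)}
    (hA : MeasurableSet A) :
    ν.reversibleMeasure p w (Nc i c ∩ A) = rootWeight ν p w i c * ν.graftLaw i c A := by
  rw [reversibleMeasure, Measure.sum_apply _ ((measurableSet_Nc i c).inter hA),
    tsum_eq_single (i, c)]
  · change rootWeight ν p w i c * ν.graftLaw i c (Nc i c ∩ A) = _
    rw [graftLaw_Nc_inter]
  · rintro ⟨i', c'⟩ hne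
    change rootWeight ν p w i' c' * ν.graftLaw i' c' (Nc i c ∩ A) = 0
    rw [graftLaw_Nc_inter_of_ne, mul_zero]
    rintro ⟨rfl, rfl⟩
    exact hne rfl

theorem reversibleMeasure_Nc (i : Fin n) (c : Fin n → ℕ) :
    ν.reversibleMeasure p w (Nc i c) = rootWeight ν p w i c := by
  have := reversibleMeasure_Nc_inter (ν := ν) (p := p) (w := w) i c MeasurableSet.univ
  rwa [inter_univ, measure_univ, mul_one] at this

/-- By the multinomial form, the neighbours of the root other than a marked one of type `j` are
distributed as the children of an individual. -/
theorem edgeMass_reversibleMeasure (hν : ν.StronglyConnected) (hp : HasMultinomialOffspring ν p)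
    (hw : ∀ i, 0 < w i) (i j : Fin n) (d : Fin n → ℕ) :
    edgeMass (ν.reversibleMeasure p w) i j d =
      ENNReal.ofReal (w i * p i j) * ν.offspring i d := by
  rw [hν.hasMultinomialOffspring_iff] at hp
  have h0 : d + Pi.single j 1 ≠ 0 := by
    intro h
    have := congrFun h j
    simp at this
  have hd : ((∑ k, d k + 1 : ℕ) : ℝ≥0∞) ≠ 0 := by simp
  have h1 : ((d j : ℝ≥0∞) + 1) * ENNReal.ofReal (multi (p i) (d + Pi.single j 1)) =
      ((∑ k, d k + 1 : ℕ) : ℝ≥0∞) * (ENNReal.ofReal (p i j) * ENNReal.ofReal (multi (p i) d)) := by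
    have := congrArg ENNReal.ofReal (multi_add_single (p i) d j)
    rw [ENNReal.ofReal_mul (by positivity), ENNReal.ofReal_mul (by positivity),
      ENNReal.ofReal_mul (hp.1 i j), ENNReal.ofReal_natCast] at this
    rw [← this]
    congr 1
    rw [ENNReal.ofReal_add (by positivity) (by positivity), ENNReal.ofReal_natCast,
      ENNReal.ofReal_one]
  rw [edgeMass, reversibleMeasure_Nc, rootWeight, if_neg h0, sum_add_single, Nat.add_sub_cancel,
    hp.2.2 i d, ENNReal.ofReal_mul (hw i).le, div_eq_mul_inv]
  calc ((d j : ℝ≥0∞) + 1) * (ENNReal.ofReal (w i) * (ν.sizeProb i (∑ k, d k) *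
        ENNReal.ofReal (multi (p i) (d + Pi.single j 1))) * ((∑ k, d k + 1 : ℕ) : ℝ≥0∞)⁻¹)
      = ENNReal.ofReal (w i) * ν.sizeProb i (∑ k, d k) * ((∑ k, d k + 1 : ℕ) : ℝ≥0∞)⁻¹ *
        (((d j : ℝ≥0∞) + 1) * ENNReal.ofReal (multi (p i) (d + Pi.single j 1))) := by ring
    _ = ENNReal.ofReal (w i) * ν.sizeProb i (∑ k, d k) *
        (ENNReal.ofReal (p i j) * ENNReal.ofReal (multi (p i) d)) *
        (((∑ k, d k + 1 : ℕ) : ℝ≥0∞)⁻¹ * ((∑ k, d k + 1 : ℕ) : ℝ≥0∞)) := by rw [h1]; ring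
    _ = _ := by
      rw [ENNReal.inv_mul_cancel hd (ENNReal.natCast_ne_top _)]
      ring

theorem reversibleMeasure_N (hν : ν.StronglyConnected) (hp : HasMultinomialOffspring ν p)
    (hw : ∀ i, 0 < w i) (i : Fin n) :
    ν.reversibleMeasure p w (N i) = ENNReal.ofReal (w i) := by
  have h1 := sum_edgeMass (ν.reversibleMeasure p w) i 1
  have h2 := tsum_Nc (ν.reversibleMeasure p w) i univ
  have h3 : ∀ c, (if c = 0 then 0 else
      ν.reversibleMeasure p w (Nc i c) * (1 : (Fin n → ℕ) → ℝ≥0∞) c) =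
      ν.reversibleMeasure p w (Nc i c) * (univ : Set (Fin n → ℕ)).indicator 1 c := by
    intro c
    split_ifs with hc
    · rw [hc, reversibleMeasure_Nc, rootWeight, if_pos rfl, zero_mul]
    · rw [indicator_univ]
  rw [tsum_congr h3, h2, preimage_univ, inter_univ] at h1
  rw [← h1]
  simp only [edgeMass_reversibleMeasure hν hp hw, Pi.one_apply, mul_one, ENNReal.tsum_mul_left,
    PMF.tsum_coe]
  rw [← ENNReal.ofReal_sum_of_nonneg fun j _ => mul_nonneg (hw i).le (hp.1 i j),
    ← Finset.mul_sum, hp.2.1, mul_one]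

theorem isReversibleFor_reversibleMeasure (hν : ν.StronglyConnected)
    (hp : HasMultinomialOffspring ν p) (hw : ∀ i, 0 < w i)
    (hbal : ∀ i j, w i * p i j = w j * p j i) (hsum : ∑ i, w i = 1) :
    IsReversibleFor ν (ν.reversibleMeasure p w) := by
  have hprob : IsProbabilityMeasure (ν.reversibleMeasure p w) := by
    refine ⟨?_⟩
    rw [← sum_measure_N]
    simp only [reversibleMeasure_N hν hp hw]
    rw [← ENNReal.ofReal_sum_of_nonneg fun i _ => (hw i).le, hsum, ENNReal.ofReal_one]
  have hdesc : ν.Describes (ν.reversibleMeasure p w) := by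
    intro i c hc
    ext A hA
    rw [ProbabilityTheory.cond_apply (measurableSet_Nc i c), reversibleMeasure_Nc_inter i c hA,
      ← mul_assoc, reversibleMeasure_Nc, ENNReal.inv_mul_cancel, one_mul]
    · rwa [reversibleMeasure_Nc] at hc
    · rw [← reversibleMeasure_Nc]
      exact measure_ne_top _ _
  refine ⟨hprob, hdesc.reversible ?_ (fun i j => ENNReal.ofReal (w i * p i j))
    (fun i j => by rw [hbal]) (edgeMass_reversibleMeasure hν hp hw), hdesc⟩
  have : ∀ i, ∀ᵐ t ∂ν.reversibleMeasure p w, t ∉ Nc i 0 := by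
    intro i
    rw [← measure_eq_zero_iff_ae_notMem, reversibleMeasure_Nc, rootWeight, if_pos rfl]
  filter_upwards [ae_all_iff.2 this] with t ht
  refine Nat.pos_of_ne_zero fun h0 => ht (rootLabel t) ⟨rfl, funext fun k => ?_⟩
  exact Finset.sum_eq_zero_iff.1 h0 k (Finset.mem_univ k)

end GW

/-- Two reversible measures have the same step matrix, hence the same law of the label of the root,
hence the same law of the neighbours of the root, which together with `ν` determines the measure. -/
theorem IsReversibleFor.unique {ν : GW n} (hν : ν.StronglyConnected) {μ μ' : Measure (Tn n)}
    (h : IsReversibleFor ν μ) (h' : IsReversibleFor ν μ') : μ' = μ := by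
  have := h.1
  have := h'.1
  have hp : stepMatrix μ' = stepMatrix μ :=
    (h'.hasMultinomialOffspring hν).unique (h.hasMultinomialOffspring hν) hν
  have hw : (fun i => μ'.real (N i)) = fun i => μ.real (N i) :=
    RootEquations.unique ((h.hasMultinomialOffspring hν).reachable hν)
      (fun i j => h.stepMatrix_pos_symm hν) (hp ▸ h'.rootEquations hν) (h.rootEquations hν)
      (h.real_N_pos hν)
  have hflux : ∀ i j, GW.flux μ' i j = GW.flux μ i j := by
    intro i j
    rw [← ENNReal.toReal_eq_toReal_iff' (h'.flux_ne_top i j) (h.flux_ne_top i j),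
      h'.flux_toReal hν, h.flux_toReal hν, hp, congrFun hw i]
  have hNc : ∀ i c, μ' (Nc i c) = μ (Nc i c) := by
    intro i c
    by_cases hc : c = 0
    · rw [hc, h.measure_Nc_zero, h'.measure_Nc_zero]
    obtain ⟨j, hj⟩ : ∃ j, c j ≠ 0 := by
      by_contra! hall
      exact hc (funext hall)
    obtain ⟨d, rfl⟩ := GW.exists_eq_add_single hj
    have h1 := (h'.edgeMass_eq i j d).trans ((congrArg (· * _) (hflux i j)).trans
      (h.edgeMass_eq i j d).symm)
    have hd : ((∑ k, (d + Pi.single j 1 : Fin n → ℕ) k : ℕ) : ℝ≥0∞) ≠ 0 := by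
      rw [GW.sum_add_single]
      simp
    rw [GW.edgeMass, GW.edgeMass, ENNReal.mul_right_inj (by simp)
      (ENNReal.add_ne_top.2 ⟨ENNReal.natCast_ne_top _, ENNReal.one_ne_top⟩)] at h1
    rwa [div_eq_mul_inv, div_eq_mul_inv, ENNReal.mul_left_inj
      (ENNReal.inv_ne_zero.2 (ENNReal.natCast_ne_top _)) (ENNReal.inv_ne_top.2 hd)] at h1
  rw [h.2.2.eq_sum, h'.2.2.eq_sum]
  simp only [hNc]

end GWTree

theorem mainTheorem2 {n : ℕ} (ν : GWTree.GW n) (hν : ν.StronglyConnected) :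
    ((∃ μ : MeasureTheory.Measure (GWTree.Tn n), GWTree.IsReversibleFor ν μ) ↔
      ∃ p : Fin n → Fin n → ℝ,
        GWTree.HasMultinomialOffspring ν p ∧ GWTree.CycleCondition p) ∧
    ∀ (p : Fin n → Fin n → ℝ) (μ : MeasureTheory.Measure (GWTree.Tn n)),
      GWTree.HasMultinomialOffspring ν p → GWTree.IsReversibleFor ν μ →
        (∀ μ' : MeasureTheory.Measure (GWTree.Tn n), GWTree.IsReversibleFor ν μ' → μ' = μ) ∧
        (∀ i d, d + 1 ∈ GWTree.D (GWTree.nbrLaw μ i) ↔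
          d ∈ GWTree.D (GWTree.nbrLaw ν.law i)) ∧
        (∀ i d, GWTree.nbrLaw μ i (GWTree.ofSize (d + 1)) =
          GWTree.nbrLaw ν.law i (GWTree.ofSize d)) ∧
        (∀ i, 0 < μ.real (GWTree.N i)) ∧
        GWTree.RootEquations p (fun i => μ.real (GWTree.N i)) ∧
        ∀ w : Fin n → ℝ, GWTree.RootEquations p w → w = fun i => μ.real (GWTree.N i) := by
  refine ⟨⟨?_, ?_⟩, ?_⟩
  · rintro ⟨μ, h⟩
    exact ⟨_, h.hasMultinomialOffspring hν, h.cycleCondition hν⟩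
  · rintro ⟨p, hp, hc⟩
    obtain ⟨o, -⟩ := ν.rootType.support_nonempty
    obtain ⟨w, hw, hbal, hsum⟩ := hc.exists_weights hp.1 (hp.reachable hν) o
    exact ⟨_, GWTree.GW.isReversibleFor_reversibleMeasure hν hp hw hbal hsum⟩
  · intro p μ hp h
    obtain rfl := hp.unique (h.hasMultinomialOffspring hν) hν
    refine ⟨fun μ' h' => h.unique hν h', fun i d => ?_, h.nbrLaw_apply hν, h.real_N_pos hν,
      h.rootEquations hν, fun w hw => ?_⟩
    · rw [GWTree.GW.mem_D_iff, GWTree.GW.mem_D_iff, h.nbrLaw_apply hν]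
    · exact hw.unique (hp.reachable hν) (fun i j => h.stepMatrix_pos_symm hν)
        (h.rootEquations hν) (h.real_N_pos hν)
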